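/- Let $H$ be a real separable Hilbert space and let $\Gamma:H\to H$ be a bounded self-adjoint trace class operator with $\langle\Gamma z,z\rangle\ge 0$ for all $z\in H$. Write $\|\cdot\|_{\mathrm{op}}$ for the operator norm and $\|T\|_{\mathrm{HS}}=(\sum_j\|Te_j\|^2)^{1/2}$ for the Hilbert–Schmidt norm, where $(e_j)$ is any complete orthonormal system of $H$; the same symbols denote the spectral and Frobenius norms of a matrix. A Bochner integrable $H$-valued random variable $Z$ is sub-gaussian with respect to $\Gamma$ if there is $\alpha\ge0$ with $$E\,e^{\langle z,Z-EZ\rangle}\le e^{\alpha^2\langle\Gamma z,z\rangle/2}\qquad\text{for all }z\in H,$$ and $\|Z\|_{\psi_2,\Gamma}$ is the infimum of all such $\alpha$. For every constant $C_0>0$ there is a constant $C>0$, depending only on $C_0$, such that the following holds for all $H$ and $\Gamma$ as above. Let $X_1,\dots,X_n$ be independent $H$-valued random variables on a probability space with $EX_i=0$ that are sub-gaussian with respect to $\Gamma$. Put $L_i=\|X_i\|_{\psi_2,\Gamma}$, $L=\max_i L_i$, and let $\Sigma_i=E[X_i\otimes X_i]$ be the covariance operator of $X_i$, where $(a\otimes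 b)z=\langle b,z\rangle a$. Assume the Bernstein condition $$E\bigl|\|X_i\|^2-E\|X_i\|^2\bigr|^k\le C_0\,k!\,(L_i^{2}\|\Gamma\|_{\mathrm{op}})^{k-2}\,\|\Sigma_i\|_{\mathrm{HS}}^2\qquad\text{for all }i=1,\dots,n\text{ and all integers }k\ge3.$$ Let $A=(a_{ij})$ be a real $n\times n$ matrix and $Q=\sum_{i,j=1}^n a_{ij}\langle X_i,X_j\rangle$. Then $Q$ is integrable and for every $t>0$ $$P\bigl(|Q-EQ|\ge t\bigr)\le 2\exp\left[-C\min\left(\frac{t^2}{L^4\|\Gamma\|_{\mathrm{HS}}^2\|A\|_{\mathrm{HS}}^2},\ \frac{t}{L^2\|\Gamma\|_{\mathrm{op}}\|A\|_{\mathrm{op}}}\right)\right],$$ where, if $L$, $\Gamma$ or $A$ is zero, both quotients are read as $+\infty$ and the right-hand side as $0$. -/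

import Mathlib

open MeasureTheory ProbabilityTheory
open scoped RealInnerProductSpace Nat

noncomputable section

namespace HilbertHW

section Operators

variable {ι H : Type*} [NormedAddCommGroup H] [InnerProductSpace ℝ H] [CompleteSpace H]

/-- The bounded operator `Γ` is self-adjoint, satisfies `⟪Γ z, z⟫ ≥ 0` for all `z`, and is trace
class: the sum `∑ j, ⟪Γ (e j), e j⟫` over the complete orthonormal system `e` converges
(a positive `Γ` is its own absolute value, so this sum is its trace norm; neither its value
nor its convergence depends on `e`). -/
def IsPositiveTraceClass (e : HilbertBasis ι ℝ H) (Γ : H →L[ℝ] H) : Prop :=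
  Γ.IsPositive ∧ Summable fun j => ⟪Γ (e j), e j⟫

/-- The Hilbert-Schmidt norm `(∑ j, ‖T (e j)‖ ^ 2) ^ (1 / 2)` of an operator, computed in the
complete orthonormal system `e` (its value does not depend on `e`). It is applied only to positive
trace class operators, for which the sum converges. -/
def hsNorm (e : HilbertBasis ι ℝ H) (T : H →L[ℝ] H) : ℝ :=
  √(∑' j, ‖T (e j)‖ ^ 2)

end Operators

section Subgaussian

variable {H Ω : Type*} [NormedAddCommGroup H] [InnerProductSpace ℝ H] [CompleteSpace H]
  [MeasurableSpace Ω]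

/-- `E exp ⟪z, Z - E Z⟫` is finite and at most `exp (α ^ 2 * ⟪Γ z, z⟫ / 2)`, for all `z`. -/
def SubgaussianBound (Γ : H →L[ℝ] H) (Z : Ω → H) (μ : Measure Ω) (α : ℝ) : Prop :=
  ∀ z : H, Integrable (fun ω => Real.exp ⟪z, Z ω - ∫ ω', Z ω' ∂μ⟫) μ ∧
    ∫ ω, Real.exp ⟪z, Z ω - ∫ ω', Z ω' ∂μ⟫ ∂μ ≤ Real.exp (α ^ 2 * ⟪Γ z, z⟫ / 2)

/-- `Z` has a Bochner mean and is sub-gaussian with respect to `Γ`. -/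
def IsSubgaussian (Γ : H →L[ℝ] H) (Z : Ω → H) (μ : Measure Ω) : Prop :=
  Integrable Z μ ∧ ∃ α : ℝ, 0 ≤ α ∧ SubgaussianBound Γ Z μ α

/-- The sub-gaussian (`ψ₂`) norm of `Z` with respect to `Γ`. -/
def psi2Norm (Γ : H →L[ℝ] H) (Z : Ω → H) (μ : Measure Ω) : ℝ :=
  sInf {α : ℝ | 0 ≤ α ∧ SubgaussianBound Γ Z μ α}

/-- The Bernstein moment condition with constant `C₀` on `‖Z‖ ^ 2 - E ‖Z‖ ^ 2`. Here
`covarianceOperator (μ.map Z)` is Mathlib's uncentered covariance operator `E [Z ⊗ Z]`. -/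
def BernsteinSqNorm {ι : Type*} [MeasurableSpace H] [BorelSpace H] (e : HilbertBasis ι ℝ H)
    (Γ : H →L[ℝ] H) (Z : Ω → H) (μ : Measure Ω) (C₀ : ℝ) : Prop :=
  ∀ k : ℕ, 3 ≤ k →
    Integrable (fun ω => |‖Z ω‖ ^ 2 - ∫ ω', ‖Z ω'‖ ^ 2 ∂μ| ^ k) μ ∧
    ∫ ω, |‖Z ω‖ ^ 2 - ∫ ω', ‖Z ω'‖ ^ 2 ∂μ| ^ k ∂μ ≤
      C₀ * (k ! : ℝ) * (psi2Norm Γ Z μ ^ 2 * ‖Γ‖) ^ (k - 2) *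
        hsNorm e (covarianceOperator (μ.map Z)) ^ 2

/-- The quadratic form `Q = ∑ i, ∑ j, a i j * ⟪X i, X j⟫`. -/
def quadForm {n : ℕ} (A : Matrix (Fin n) (Fin n) ℝ) (X : Fin n → Ω → H) (ω : Ω) : ℝ :=
  ∑ i, ∑ j, A i j * ⟪X i ω, X j ω⟫

end Subgaussian

/-- The Hilbert-Schmidt (Frobenius) norm of a matrix. -/
def matHSNorm {n : ℕ} (A : Matrix (Fin n) (Fin n) ℝ) : ℝ :=
  √(∑ i, ∑ j, A i j ^ 2)

/-- The `ℓ² → ℓ²` operator norm of a matrix. -/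
def matOpNorm {n : ℕ} (A : Matrix (Fin n) (Fin n) ℝ) : ℝ :=
  ‖Matrix.toEuclideanCLM (n := Fin n) (𝕜 := ℝ) A‖

end HilbertHW

end

noncomputable section

namespace HilbertHW

open scoped ENNReal

set_option linter.unusedSectionVars false

/-! Chernoff's method reduces the claim to a Gaussian bound `E exp (l (Q - EQ)) ≤ exp (K l² L⁴
‖Γ‖_HS² ‖A‖_HS²)` for `|l| L² ‖Γ‖ ‖A‖_op ≤ 1/12`. Split `Q - EQ` into its diagonal and off-diagonal
parts. By convexity of `exp` it suffices to bound the exponential moment of twice each part, so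
their dependence is harmless.

The diagonal part is a sum of independent centred variables `A i i (‖X i‖² - E‖X i‖²)`.
Sub-gaussianity gives `Σ_i ≤ L² Γ`, hence `‖Σ_i‖_HS ≤ L² ‖Γ‖_HS` (`hsNorm_covarianceOperator_le`).
This turns the Bernstein moments into moments with scale `b = L² ‖Γ‖` and size `V = L² ‖Γ‖_HS`,
which the exponential series sums (`expMoment_le_of_bernstein`).

The off-diagonal part is an average over index sets `I` of four times its `I × Iᶜ` blocks, so by
convexity one block is enough. With the variables outside `I` frozen, a block is linear in the
others. Sub-gaussianity then leaves `exp (s ∑ ⟪Γ w i, w i⟫)`, where `w = B X` and `B` is the block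
of `A` (`expMoment_block_le`). To integrate this quadratic form, compress `Γ` to a finite part of
the basis, diagonalise the compression and `Bᵀ B`, and linearise the squares by auxiliary standard
Gaussians. Sub-gaussianity, used a second time, yields products of one-dimensional Gaussian
integrals. The sums of `d m ^ 2` and of `σ p` over the two spectra produce `‖Γ‖_HS²` and `‖A‖_HS²`,
and their largest elements the restriction on `l`. Fatou's lemma removes the compression.

Exponential moments live in `[0, ∞]`, so Tonelli and Fatou apply without integrability conditions.
When `L² ‖Γ‖ ‖A‖_op = 0`, `Q` vanishes almost surely. -/

/-- The exponential moment `E exp f`, as an extended nonnegative real. -/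
def expMoment {Ω : Type*} [MeasurableSpace Ω] (μ : Measure Ω) (f : Ω → ℝ) : ℝ≥0∞ :=
  ∫⁻ ω, ENNReal.ofReal (Real.exp (f ω)) ∂μ

/-! ### Spectral theorem for matrices in coordinates -/

section Matrices

variable {κ : Type*} [Fintype κ] [DecidableEq κ]

/-- Diagonalisation of a real positive semidefinite matrix, in coordinates. -/
theorem exists_diagonalization (M : Matrix κ κ ℝ) (hM : M.IsHermitian) (c : ℝ)
    (h0 : ∀ x : κ → ℝ, 0 ≤ ∑ j, ∑ k, M j k * x j * x k)
    (hc : ∀ x : κ → ℝ, ∑ j, ∑ k, M j k * x j * x k ≤ c * ∑ j, x j ^ 2) :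
    ∃ (u : κ → κ → ℝ) (d : κ → ℝ),
      (∀ p q, ∑ j, u p j * u q j = if p = q then 1 else 0) ∧
      (∀ j k, M j k = ∑ p, d p * u p j * u p k) ∧
      (∀ p, 0 ≤ d p) ∧ (∀ p, d p ≤ c) ∧ ∑ p, d p = ∑ j, M j j ∧
      ∑ p, d p ^ 2 = ∑ j, ∑ k, M j k ^ 2 := by
  set U : Matrix κ κ ℝ := (hM.eigenvectorUnitary : Matrix κ κ ℝ) with hU
  set d := hM.eigenvalues with hd
  have h1 : ∀ p q, ∑ j, U j p * U j q = if p = q then 1 else 0 := by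
    intro p q
    have h := congrFun (congrFun (Matrix.mem_unitaryGroup_iff'.1 hM.eigenvectorUnitary.2) p) q
    simpa [Matrix.mul_apply, Matrix.one_apply, Matrix.star_apply, hU] using h
  have h2 : ∀ j k, M j k = ∑ p, d p * U j p * U k p := by
    intro j k
    have h := congrFun (congrFun hM.spectral_theorem j) k
    rw [h]
    simp only [Unitary.conjStarAlgAut_apply, Matrix.mul_apply, Matrix.diagonal_apply,
      Matrix.star_apply]
    refine Finset.sum_congr rfl fun p _ => ?_
    simp [hU, hd]
    left
    ring
  -- Each eigenvalue is the value of the form at its unit eigenvector, so bounds on the form pass to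
  -- the spectrum.
  have hev : ∀ p, ∑ j, ∑ k, M j k * U j p * U k p = d p := by
    intro p
    have : ∀ j k, M j k * U j p * U k p = ∑ q, d q * ((U j q * U j p) * (U k q * U k p)) := by
      intro j k
      rw [h2, Finset.sum_mul, Finset.sum_mul]
      exact Finset.sum_congr rfl fun q _ => by ring
    simp_rw [this]
    have : ∀ j, ∑ k, ∑ q, d q * ((U j q * U j p) * (U k q * U k p)) =
        d p * (U j p * U j p) := by
      intro j
      rw [Finset.sum_comm]
      simp_rw [← Finset.mul_sum, h1]
      simp
    simp_rw [this, ← Finset.mul_sum, h1]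
    simp
  refine ⟨fun p j => U j p, d, h1, h2, fun p => ?_, fun p => ?_, ?_, ?_⟩
  · rw [← hev p]; exact h0 _
  · rw [← hev p]
    refine (hc _).trans ?_
    have := h1 p p
    simp only [← pow_two, if_true] at this
    rw [this, mul_one]
  · simp_rw [h2]
    rw [Finset.sum_comm]
    refine Finset.sum_congr rfl fun p _ => ?_
    simp_rw [mul_assoc, ← Finset.mul_sum, h1]
    simp
  · have : ∀ j k, M j k ^ 2 = ∑ p, d p * (M j k * U j p * U k p) := by
      intro j k
      rw [pow_two]
      nth_rw 2 [h2]
      rw [Finset.mul_sum]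
      exact Finset.sum_congr rfl fun q _ => by ring
    simp_rw [this]
    have : ∀ j, ∑ k, ∑ p, d p * (M j k * U j p * U k p) =
        ∑ p, d p * ∑ k, (M j k * U j p * U k p) := by
      intro j
      rw [Finset.sum_comm]
      simp_rw [← Finset.mul_sum]
    simp_rw [this]
    rw [Finset.sum_comm]
    simp_rw [← Finset.mul_sum, hev, pow_two]

end Matrices

/-! ### Exponential moments and Gaussian linearisation -/

section ExpMoments

variable {Ω : Type*} [MeasurableSpace Ω] {μ : Measure Ω}

theorem expMoment_congr {f g : Ω → ℝ} (h : ∀ ω, f ω = g ω) : expMoment μ f = expMoment μ g := by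
  rw [funext h]

theorem expMoment_sum_eq_prod {κ : Type*} [Fintype κ] {Y : κ → Ω → ℝ}
    (hY : iIndepFun Y μ) (hm : ∀ i, Measurable (Y i)) :
    expMoment μ (fun ω => ∑ i, Y i ω) = ∏ i, expMoment μ (Y i) := by
  have h := lintegral_prod_eq_prod_lintegral_of_indepFun (μ := μ) Finset.univ
    (fun i ω => ENNReal.ofReal (Real.exp (Y i ω)))
    (hY.comp (fun _ x => ENNReal.ofReal (Real.exp x)) fun _ => by fun_prop)
    (fun i => by have := hm i; fun_prop)
  unfold expMoment
  rw [← h]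
  refine lintegral_congr fun ω => ?_
  rw [Real.exp_sum, ENNReal.ofReal_prod_of_nonneg fun i _ => (Real.exp_pos _).le]

theorem expMoment_gaussian_linear (a : ℝ) :
    expMoment (gaussianReal 0 1) (fun x => a * x) = ENNReal.ofReal (Real.exp (a ^ 2 / 2)) := by
  rw [expMoment, ← ofReal_integral_eq_lintegral_ofReal (integrable_exp_mul_gaussianReal a)
    (Filter.Eventually.of_forall fun x => (Real.exp_pos _).le)]
  have := congrFun (mgf_id_gaussianReal (μ := 0) (v := 1)) a
  simp only [mgf, id] at this
  rw [this]
  simp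

/-- The exact value is `(1 - b) ^ (-1/2)`, and `1 / (1 - b) ≤ exp (2 b)` on this range of `b`. -/
theorem expMoment_gaussian_sq_le {b : ℝ} (hb0 : 0 ≤ b) (hb : b ≤ 1 / 2) :
    expMoment (gaussianReal 0 1) (fun x => b * x ^ 2 / 2) ≤ ENNReal.ofReal (Real.exp b) := by
  have hpos : 0 < 1 - b := by linarith
  rw [expMoment, gaussianReal_of_var_ne_zero _ one_ne_zero,
    lintegral_withDensity_eq_lintegral_mul _ (measurable_gaussianPDF 0 1) (by fun_prop)]
  have h1 : ∀ x : ℝ, (gaussianPDF 0 1 * fun x => ENNReal.ofReal (Real.exp (b * x ^ 2 / 2))) x =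
      ENNReal.ofReal ((√(2 * Real.pi))⁻¹ * Real.exp (-((1 - b) / 2) * x ^ 2)) := by
    intro x
    rw [Pi.mul_apply, gaussianPDF, ← ENNReal.ofReal_mul (gaussianPDFReal_nonneg _ _ _),
      gaussianPDFReal]
    congr 1
    rw [mul_assoc, ← Real.exp_add]
    simp only [NNReal.coe_one, mul_one, sub_zero]
    congr 2
    ring
  simp_rw [h1]
  rw [← ofReal_integral_eq_lintegral_ofReal
    ((integrable_exp_neg_mul_sq (by positivity)).const_mul _)
    (Filter.Eventually.of_forall fun x => by positivity)]
  refine ENNReal.ofReal_le_ofReal ?_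
  rw [integral_const_mul, integral_gaussian, inv_mul_le_iff₀ (by positivity)]
  refine Real.sqrt_le_iff.2 ⟨by positivity, ?_⟩
  rw [mul_pow, Real.sq_sqrt (by positivity), ← Real.exp_nat_mul]
  have h2 : 1 / (1 - b) ≤ Real.exp (2 * b) := by
    have h3 : 1 / (1 - b) = b / (1 - b) + 1 := by field_simp; ring
    rw [h3]
    refine (Real.add_one_le_exp _).trans (Real.exp_le_exp.2 ?_)
    rw [div_le_iff₀ hpos]
    nlinarith
  calc Real.pi / ((1 - b) / 2) = 2 * Real.pi * (1 / (1 - b)) := by field_simp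
    _ ≤ _ := by
      push_cast
      gcongr

theorem expMoment_pi_gaussian {κ : Type*} [Fintype κ] (f : κ → ℝ → ℝ)
    (hf : ∀ q, Measurable (f q)) :
    expMoment (Measure.pi fun _ : κ => gaussianReal 0 1) (fun g => ∑ q, f q (g q)) =
      ∏ q, expMoment (gaussianReal 0 1) (f q) := by
  refine (expMoment_sum_eq_prod (Y := fun q (g : κ → ℝ) => f q (g q))
    (iIndepFun_pi fun q => (hf q).aemeasurable)
    (fun q => (hf q).comp (measurable_pi_apply q))).trans ?_
  refine Finset.prod_congr rfl fun q _ => ?_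
  have hp := measurePreserving_eval (fun _ : κ => gaussianReal 0 1) q
  exact hp.lintegral_comp (f := fun x => ENNReal.ofReal (Real.exp (f q x)))
    (by have := hf q; fun_prop)

/-- A quadratic form in a sub-gaussian vector with diagonal variance proxy `v`. -/
theorem expMoment_sq_le [SFinite μ] {κ : Type*} [Fintype κ] {Z : κ → Ω → ℝ}
    (hZ : ∀ q, Measurable (Z q)) {v τ : κ → ℝ} (hv : ∀ q, 0 ≤ v q) (hτ : ∀ q, 0 ≤ τ q)
    (hsub : ∀ c : κ → ℝ, expMoment μ (fun ω => ∑ q, c q * Z q ω) ≤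
      ENNReal.ofReal (Real.exp (∑ q, v q * c q ^ 2 / 2)))
    (hτv : ∀ q, τ q * v q ≤ 1 / 2) :
    expMoment μ (fun ω => ∑ q, τ q * Z q ω ^ 2 / 2) ≤
      ENNReal.ofReal (Real.exp (∑ q, τ q * v q)) := by
  set G := Measure.pi fun _ : κ => gaussianReal 0 1 with hG
  -- Since `exp (τ z² / 2) = E exp (√τ z g)` for a standard Gaussian `g`, the square becomes linear
  -- in `Z`; Tonelli then allows integrating `Z` first.
  have h1 : ∀ ω, ENNReal.ofReal (Real.exp (∑ q, τ q * Z q ω ^ 2 / 2)) =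
      expMoment G (fun g => ∑ q, (√(τ q) * Z q ω) * g q) := by
    intro ω
    rw [hG, expMoment_pi_gaussian (fun q x => (√(τ q) * Z q ω) * x) (fun q => by fun_prop)]
    simp_rw [expMoment_gaussian_linear]
    rw [← ENNReal.ofReal_prod_of_nonneg fun i _ => (Real.exp_pos _).le, ← Real.exp_sum]
    congr 3
    ext q
    rw [mul_pow, Real.sq_sqrt (hτ q)]
  calc expMoment μ (fun ω => ∑ q, τ q * Z q ω ^ 2 / 2)
      = ∫⁻ ω, ∫⁻ g, ENNReal.ofReal (Real.exp (∑ q, (√(τ q) * Z q ω) * g q)) ∂G ∂μ :=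
        lintegral_congr h1
    _ = ∫⁻ g, ∫⁻ ω, ENNReal.ofReal (Real.exp (∑ q, (√(τ q) * Z q ω) * g q)) ∂μ ∂G := by
        refine lintegral_lintegral_swap (Measurable.aemeasurable ?_)
        unfold Function.uncurry
        fun_prop
    _ ≤ ∫⁻ g, ENNReal.ofReal (Real.exp (∑ q, (τ q * v q) * g q ^ 2 / 2)) ∂G := by
        refine lintegral_mono fun g => ?_
        have h := hsub fun q => √(τ q) * g q
        rw [expMoment] at h
        calc _ = ∫⁻ ω, ENNReal.ofReal (Real.exp (∑ q, √(τ q) * g q * Z q ω)) ∂μ := by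
              refine lintegral_congr fun ω => ?_
              congr 3; ext q; ring
          _ ≤ _ := h
          _ = _ := by
              congr 3; ext q
              rw [mul_pow, Real.sq_sqrt (hτ q)]; ring
    _ = ∏ q, expMoment (gaussianReal 0 1) (fun x => (τ q * v q) * x ^ 2 / 2) :=
        expMoment_pi_gaussian (fun q x => (τ q * v q) * x ^ 2 / 2) (fun q => by fun_prop)
    _ ≤ ∏ q, ENNReal.ofReal (Real.exp (τ q * v q)) := by
        refine Finset.prod_le_prod' fun q _ => ?_
        exact expMoment_gaussian_sq_le (mul_nonneg (hτ q) (hv q)) (hτv q)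
    _ = _ := by
        rw [← ENNReal.ofReal_prod_of_nonneg fun i _ => (Real.exp_pos _).le, ← Real.exp_sum]

end ExpMoments

/-! ### Singular values -/

section Matrices

variable {κ : Type*} [Fintype κ] [DecidableEq κ]

/-- The singular value decomposition of a square matrix `B`, from the side of `Bᵀ B`. -/
theorem exists_singular_values (B : Matrix κ κ ℝ) (b : ℝ)
    (hB : ∀ x : κ → ℝ, ∑ i, (∑ j, B i j * x j) ^ 2 ≤ b ^ 2 * ∑ j, x j ^ 2) :
    ∃ (r : κ → κ → ℝ) (σ : κ → ℝ),
      (∀ p q, ∑ j, r p j * r q j = if p = q then 1 else 0) ∧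
      (∀ x : κ → ℝ, ∑ i, (∑ j, B i j * x j) ^ 2 = ∑ p, σ p * (∑ j, r p j * x j) ^ 2) ∧
      (∀ p, 0 ≤ σ p) ∧ (∀ p, σ p ≤ b ^ 2) ∧ ∑ p, σ p = ∑ i, ∑ j, B i j ^ 2 := by
  have key : ∀ x : κ → ℝ, ∑ j, ∑ k, (B.transpose * B) j k * x j * x k =
      ∑ i, (∑ j, B i j * x j) ^ 2 := by
    intro x
    simp_rw [Matrix.mul_apply, Matrix.transpose_apply, pow_two, Finset.sum_mul_sum,
      Finset.sum_mul]
    rw [Finset.sum_comm' (t' := Finset.univ) (s' := fun _ => Finset.univ) (by simp)]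
    rw [eq_comm, Finset.sum_comm]
    rw [Finset.sum_comm]
    rw [Finset.sum_congr rfl fun i _ => Finset.sum_comm]
    rw [Finset.sum_comm]
    refine Finset.sum_congr rfl fun j _ => ?_
    rw [Finset.sum_comm]
    exact Finset.sum_congr rfl fun _ _ => Finset.sum_congr rfl fun _ _ => by ring
  obtain ⟨r, σ, h1, h2, h3, h4, h5, -⟩ := exists_diagonalization (B.transpose * B)
    (by simpa using Matrix.isHermitian_conjTranspose_mul_self B) (b ^ 2)
    (fun x => by rw [key]; positivity) (fun x => by rw [key]; exact hB x)
  refine ⟨r, σ, h1, fun x => ?_, h3, h4, ?_⟩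
  · rw [← key]
    simp_rw [h2, pow_two, Finset.sum_mul_sum, Finset.sum_mul, Finset.mul_sum]
    rw [eq_comm, Finset.sum_comm]
    refine Finset.sum_congr rfl fun j _ => ?_
    rw [Finset.sum_comm]
    exact Finset.sum_congr rfl fun _ _ => Finset.sum_congr rfl fun _ _ => by ring
  · rw [h5]
    simp_rw [Matrix.mul_apply, Matrix.transpose_apply, ← pow_two]
    rw [Finset.sum_comm]

end Matrices

/-! ### Positive trace class operators and finite compressions -/

section Operators

variable {ι H : Type*} [NormedAddCommGroup H] [InnerProductSpace ℝ H] [CompleteSpace H]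

theorem inner_basis (e : HilbertBasis ι ℝ H) [DecidableEq ι] (i j : ι) :
    ⟪e i, e j⟫ = if i = j then (1 : ℝ) else 0 :=
  orthonormal_iff_ite.1 e.orthonormal i j

/-- Parseval's identity. -/
theorem hasSum_inner_sq (e : HilbertBasis ι ℝ H) (x : H) :
    HasSum (fun j => ⟪e j, x⟫ ^ 2) (‖x‖ ^ 2) := by
  have h := e.hasSum_inner_mul_inner x x
  rw [real_inner_self_eq_norm_sq] at h
  refine h.congr_fun ?_
  intro j
  rw [real_inner_comm, pow_two]

/-- Expand the positivity of `Γ` at `x - ‖Γ‖⁻¹ • Γ x`; no square root of `Γ` is needed. -/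
theorem IsPositive.norm_sq_apply_le {Γ : H →L[ℝ] H} (hΓ : Γ.IsPositive) (x : H) :
    ‖Γ x‖ ^ 2 ≤ ‖Γ‖ * ⟪Γ x, x⟫ := by
  rcases eq_or_ne Γ 0 with rfl | h0
  · simp
  have hpos : 0 < ‖Γ‖ := norm_pos_iff.2 h0
  have h1 := hΓ.inner_nonneg_left (x - ‖Γ‖⁻¹ • Γ x)
  have h2 : ⟪Γ (Γ x), Γ x⟫ ≤ ‖Γ‖ * ‖Γ x‖ ^ 2 :=
    calc _ ≤ ‖Γ (Γ x)‖ * ‖Γ x‖ := real_inner_le_norm _ _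
      _ ≤ ‖Γ‖ * ‖Γ x‖ * ‖Γ x‖ := by gcongr; exact Γ.le_opNorm _
      _ = _ := by ring
  have h3 : ⟪Γ (Γ x), x⟫ = ‖Γ x‖ ^ 2 := by
    rw [← real_inner_self_eq_norm_sq]; exact hΓ.isSymmetric _ _
  simp only [map_sub, map_smul, inner_sub_left, inner_sub_right, real_inner_smul_left,
    real_inner_smul_right, h3, real_inner_self_eq_norm_sq] at h1
  have h4 : ‖Γ‖⁻¹ * (‖Γ‖⁻¹ * ⟪Γ (Γ x), Γ x⟫) ≤ ‖Γ‖⁻¹ * ‖Γ x‖ ^ 2 :=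
    calc _ ≤ ‖Γ‖⁻¹ * (‖Γ‖⁻¹ * (‖Γ‖ * ‖Γ x‖ ^ 2)) := by gcongr
      _ = _ := by field_simp
  have h5 : ‖Γ‖⁻¹ * ‖Γ x‖ ^ 2 ≤ ⟪Γ x, x⟫ := by linarith
  rwa [inv_mul_le_iff₀ hpos] at h5

theorem summable_norm_sq {e : HilbertBasis ι ℝ H} {Γ : H →L[ℝ] H}
    (hΓ : IsPositiveTraceClass e Γ) : Summable fun j => ‖Γ (e j)‖ ^ 2 :=
  Summable.of_nonneg_of_le (fun _ => by positivity)
    (fun j => IsPositive.norm_sq_apply_le hΓ.1 (e j)) (hΓ.2.mul_left ‖Γ‖)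

theorem hsNorm_sq (e : HilbertBasis ι ℝ H) (T : H →L[ℝ] H) :
    hsNorm e T ^ 2 = ∑' j, ‖T (e j)‖ ^ 2 :=
  Real.sq_sqrt (tsum_nonneg fun _ => by positivity)

/-- The compression of `Γ` to a finite part of a complete orthonormal system, diagonalised. -/
theorem exists_compression_eigenvectors {e : HilbertBasis ι ℝ H} {Γ : H →L[ℝ] H}
    (hΓ : IsPositiveTraceClass e Γ) (F : Finset ι) :
    ∃ (f : F → H) (d : F → ℝ),
      (∀ c : F → ℝ, ⟪Γ (∑ m, c m • f m), ∑ m, c m • f m⟫ = ∑ m, d m * c m ^ 2) ∧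
      (∀ w : H, ⟪Γ (∑ k ∈ F, ⟪e k, w⟫ • e k), ∑ k ∈ F, ⟪e k, w⟫ • e k⟫ =
        ∑ m, d m * ⟪f m, w⟫ ^ 2) ∧
      (∀ m, 0 ≤ d m) ∧ (∀ m, d m ≤ ‖Γ‖) ∧ ∑ m, d m ^ 2 ≤ hsNorm e Γ ^ 2 := by
  classical
  set M : Matrix F F ℝ := fun k l => ⟪Γ (e k), e l⟫ with hMdef
  have hsymm : ∀ x y, ⟪Γ x, y⟫ = ⟪x, Γ y⟫ := fun x y => hΓ.1.isSymmetric x y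
  have hform : ∀ x : F → ℝ, ∑ j, ∑ k, M j k * x j * x k =
      ⟪Γ (∑ k, x k • e k), ∑ k, x k • e k⟫ := by
    intro x
    simp_rw [map_sum, map_smul, sum_inner, inner_sum, real_inner_smul_left,
      real_inner_smul_right]
    exact Finset.sum_congr rfl fun _ _ => Finset.sum_congr rfl fun _ _ => by
      simp only [hMdef]; ring
  obtain ⟨u, d, h1, h2, h3, h4, -, h6⟩ := exists_diagonalization M (by
      ext j k
      rw [Matrix.conjTranspose_apply, star_trivial]
      simp only [hMdef]
      rw [hsymm, real_inner_comm]) ‖Γ‖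
    (fun x => by rw [hform]; exact hΓ.1.inner_nonneg_left _) (fun x => by
      rw [hform]
      have : ‖∑ k, x k • e (k : ι)‖ ^ 2 = ∑ j, x j ^ 2 := by
        rw [← real_inner_self_eq_norm_sq]
        simp_rw [sum_inner, inner_sum, real_inner_smul_left, real_inner_smul_right, inner_basis]
        simp [pow_two]
      rw [← this]
      calc _ ≤ ‖Γ (∑ k, x k • e k)‖ * ‖∑ k, x k • e (k : ι)‖ := real_inner_le_norm _ _
        _ ≤ ‖Γ‖ * ‖∑ k, x k • e (k : ι)‖ * ‖∑ k, x k • e (k : ι)‖ := by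
          gcongr; exact Γ.le_opNorm _
        _ = _ := by ring)
  have h2' : ∀ x : F → ℝ, ∑ j, ∑ k, M j k * x j * x k = ∑ m, d m * (∑ k, u m k * x k) ^ 2 := by
    intro x
    simp_rw [h2, pow_two, Finset.sum_mul_sum, Finset.sum_mul, Finset.mul_sum]
    rw [eq_comm, Finset.sum_comm]
    refine Finset.sum_congr rfl fun j _ => ?_
    rw [Finset.sum_comm]
    exact Finset.sum_congr rfl fun _ _ => Finset.sum_congr rfl fun _ _ => by ring
  refine ⟨fun m => ∑ k, u m k • e k, d, fun c => ?_, fun w => ?_, h3, h4, ?_⟩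
  · have : ∑ m, c m • ∑ k, u m k • e (k : ι) = ∑ k : F, (∑ m, c m * u m k) • e (k : ι) := by
      simp_rw [Finset.smul_sum, Finset.sum_smul, smul_smul]
      rw [Finset.sum_comm]
    rw [this, ← hform, h2']
    refine Finset.sum_congr rfl fun m _ => ?_
    congr 2
    simp_rw [Finset.mul_sum]
    rw [Finset.sum_comm]
    have : ∀ q, ∑ k, u m k * (c q * u q k) = c q * if m = q then 1 else 0 := by
      intro q
      rw [← h1, Finset.mul_sum]
      exact Finset.sum_congr rfl fun _ _ => by ring
    simp_rw [this]
    simp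
  · rw [← Finset.sum_coe_sort F (fun k => ⟪e k, w⟫ • e k), ← hform, h2']
    refine Finset.sum_congr rfl fun m _ => ?_
    simp_rw [sum_inner, real_inner_smul_left]
  · rw [h6, hsNorm_sq]
    -- By Parseval, passing to the compression only discards entries of the infinite matrix of `Γ`.
    calc _ ≤ ∑ k : F, ‖Γ (e k)‖ ^ 2 := by
          refine Finset.sum_le_sum fun k _ => ?_
          rw [← (hasSum_inner_sq e (Γ (e k))).tsum_eq]
          simp only [hMdef]
          rw [Finset.sum_coe_sort F (fun l => ⟪Γ (e k), e l⟫ ^ 2)]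
          simp_rw [real_inner_comm _ (Γ (e k))]
          exact (hasSum_inner_sq e (Γ (e k))).summable.sum_le_tsum _ fun _ _ => by positivity
      _ = ∑ k ∈ F, ‖Γ (e k)‖ ^ 2 := Finset.sum_coe_sort F (fun k => ‖Γ (e k)‖ ^ 2)
      _ ≤ _ := (summable_norm_sq hΓ).sum_le_tsum _ fun _ _ => by positivity

theorem norm_le_hsNorm {e : HilbertBasis ι ℝ H} {Γ : H →L[ℝ] H}
    (hΓ : IsPositiveTraceClass e Γ) : ‖Γ‖ ≤ hsNorm e Γ := by
  refine Γ.opNorm_le_bound (Real.sqrt_nonneg _) fun x => ?_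
  refine le_of_sq_le_sq ?_ (mul_nonneg (Real.sqrt_nonneg _) (norm_nonneg _))
  rw [mul_pow, hsNorm_sq, ← (hasSum_inner_sq e (Γ x)).tsum_eq, ← tsum_mul_right]
  refine Summable.tsum_le_tsum (fun j => ?_) (hasSum_inner_sq e (Γ x)).summable
    ((summable_norm_sq hΓ).mul_right _)
  have : ⟪e j, Γ x⟫ = ⟪Γ (e j), x⟫ := (hΓ.1.isSymmetric (e j) x).symm
  rw [this, ← mul_pow]
  exact sq_le_sq' (neg_le_of_abs_le (abs_real_inner_le_norm _ _)) (real_inner_le_norm _ _)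

end Operators

/-- Basis vectors lie at distance `√2`, so the balls of radius `1/2` around them are disjoint.
Countability is what lets Fatou's lemma and dominated convergence run over the basis. -/
theorem countable_of_hilbertBasis {ι H : Type*} [NormedAddCommGroup H] [InnerProductSpace ℝ H]
    [TopologicalSpace.SeparableSpace H] (e : HilbertBasis ι ℝ H) : Countable ι := by
  refine Pairwise.countable_of_isOpen_disjoint (s := fun i => Metric.ball (e i) (1 / 2))
    (fun i j hij => Metric.ball_disjoint_ball ?_) (fun _ => Metric.isOpen_ball)
    (fun i => ⟨e i, Metric.mem_ball_self (by norm_num)⟩)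
  rw [dist_eq_norm]
  have h : ‖e i - e j‖ ^ 2 = 2 := by
    rw [norm_sub_sq_real, e.orthonormal.1, e.orthonormal.1, e.orthonormal.2 hij]
    norm_num
  nlinarith [norm_nonneg (e i - e j)]

/-! ### Exponential moments of positive quadratic forms -/

section QuadraticForms

variable {κ ι H Ω : Type*} [Fintype κ] [DecidableEq κ] [NormedAddCommGroup H]
  [InnerProductSpace ℝ H] [CompleteSpace H] [MeasurableSpace H] [BorelSpace H]
  [SecondCountableTopology H] [MeasurableSpace Ω] {μ : Measure Ω}

theorem expMoment_sum_inner_le {X : κ → Ω → H} (hX : ∀ i, Measurable (X i))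
    (hind : iIndepFun X μ) {Γ : H →L[ℝ] H} {L : ℝ}
    (hsub : ∀ i z, expMoment μ (fun ω => ⟪z, X i ω⟫) ≤
      ENNReal.ofReal (Real.exp (L ^ 2 * ⟪Γ z, z⟫ / 2))) (y : κ → H) :
    expMoment μ (fun ω => ∑ i, ⟪y i, X i ω⟫) ≤
      ENNReal.ofReal (Real.exp (L ^ 2 * (∑ i, ⟪Γ (y i), y i⟫) / 2)) := by
  rw [expMoment_sum_eq_prod (Y := fun i ω => ⟪y i, X i ω⟫)
    (hind.comp (fun i x => ⟪y i, x⟫) fun _ => by fun_prop)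
    (fun i => by have := hX i; fun_prop)]
  refine (Finset.prod_le_prod' fun i _ => hsub i (y i)).trans_eq ?_
  rw [← ENNReal.ofReal_prod_of_nonneg fun i _ => (Real.exp_pos _).le, ← Real.exp_sum,
    Finset.mul_sum, Finset.sum_div]

/-- In the coordinates `∑ j, r p j * ⟪f m, X j⟫` given by the singular vectors of `B` and the
eigenvectors of the compression, the form is diagonal with weights `σ p * d m`, and the vector has
diagonal variance proxy `L ^ 2 * d m`. Hence `expMoment_sq_le` applies. -/
theorem expMoment_compressed_le [SFinite μ] {X : κ → Ω → H} (hX : ∀ i, Measurable (X i))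
    (hind : iIndepFun X μ) {e : HilbertBasis ι ℝ H} {Γ : H →L[ℝ] H}
    (hΓ : IsPositiveTraceClass e Γ) {L : ℝ}
    (hsub : ∀ i z, expMoment μ (fun ω => ⟪z, X i ω⟫) ≤
      ENNReal.ofReal (Real.exp (L ^ 2 * ⟪Γ z, z⟫ / 2)))
    (B : Matrix κ κ ℝ) {b s : ℝ}
    (hB : ∀ x : κ → ℝ, ∑ i, (∑ j, B i j * x j) ^ 2 ≤ b ^ 2 * ∑ j, x j ^ 2)
    (hs : 0 ≤ s) (hsb : s * (L ^ 2 * b ^ 2 * ‖Γ‖ ^ 2) ≤ 1 / 4) (F : Finset ι) :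
    expMoment μ (fun ω => s * ∑ i, ⟪Γ (∑ k ∈ F, ⟪e k, ∑ j, B i j • X j ω⟫ • e k),
        ∑ k ∈ F, ⟪e k, ∑ j, B i j • X j ω⟫ • e k⟫) ≤
      ENNReal.ofReal
        (Real.exp (2 * s * (L ^ 2 * hsNorm e Γ ^ 2 * ∑ i, ∑ j, B i j ^ 2))) := by
  obtain ⟨r, σ, hr, hrB, hσ0, hσb, hσs⟩ := exists_singular_values B b hB
  obtain ⟨f, d, hf, hfF, hd0, hdb, hds⟩ := exists_compression_eigenvectors hΓ F
  have hquad : ∀ ω, s * ∑ i, ⟪Γ (∑ k ∈ F, ⟪e k, ∑ j, B i j • X j ω⟫ • e k),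
        ∑ k ∈ F, ⟪e k, ∑ j, B i j • X j ω⟫ • e k⟫ =
      ∑ q : κ × F, (2 * s * (σ q.1 * d q.2)) * (∑ j, r q.1 j * ⟪f q.2, X j ω⟫) ^ 2 / 2 := by
    intro ω
    simp_rw [hfF, inner_sum, real_inner_smul_right]
    rw [Finset.sum_comm]
    simp_rw [← Finset.mul_sum, hrB, Fintype.sum_prod_type]
    rw [Finset.sum_comm, Finset.mul_sum]
    refine Finset.sum_congr rfl fun m _ => ?_
    simp_rw [Finset.mul_sum]
    exact Finset.sum_congr rfl fun p _ => by ring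
  rw [expMoment_congr hquad]
  have hdsq : ∀ m, d m ^ 2 ≤ ‖Γ‖ ^ 2 := fun m => pow_le_pow_left₀ (hd0 m) (hdb m) 2
  refine (expMoment_sq_le (Z := fun (q : κ × F) ω => ∑ j, r q.1 j * ⟪f q.2, X j ω⟫)
    (fun q => ?_) (v := fun q => L ^ 2 * d q.2) (τ := fun q => 2 * s * (σ q.1 * d q.2))
    (fun q => mul_nonneg (sq_nonneg _) (hd0 _))
    (fun q => mul_nonneg (by positivity) (mul_nonneg (hσ0 _) (hd0 _))) ?_ ?_).trans ?_
  · exact Finset.measurable_sum _ fun j _ => by have := hX j; fun_prop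
  · intro c
    have h1 : ∀ ω, ∑ q : κ × F, c q * ∑ j, r q.1 j * ⟪f q.2, X j ω⟫ =
        ∑ j, ⟪∑ m, (∑ p, c (p, m) * r p j) • f m, X j ω⟫ := by
      intro ω
      simp_rw [sum_inner, real_inner_smul_left, Fintype.sum_prod_type, Finset.mul_sum,
        Finset.sum_mul]
      rw [eq_comm, Finset.sum_comm]
      rw [Finset.sum_congr rfl fun m _ => Finset.sum_comm]
      rw [Finset.sum_comm]
      exact Finset.sum_congr rfl fun _ _ => Finset.sum_congr rfl fun _ _ =>
        Finset.sum_congr rfl fun _ _ => by ring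
    rw [expMoment_congr h1]
    refine (expMoment_sum_inner_le hX hind hsub _).trans_eq ?_
    congr 2
    simp_rw [hf]
    rw [Finset.sum_comm, Finset.mul_sum, Finset.sum_div, Fintype.sum_prod_type_right]
    refine Finset.sum_congr rfl fun m _ => ?_
    have h2 : ∑ j, (∑ p, c (p, m) * r p j) ^ 2 = ∑ p, c (p, m) ^ 2 := by
      simp_rw [pow_two, Finset.sum_mul_sum]
      rw [Finset.sum_comm]
      refine Finset.sum_congr rfl fun p _ => ?_
      rw [Finset.sum_comm]
      have : ∀ q, ∑ j, c (p, m) * r p j * (c (q, m) * r q j) =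
          c (p, m) * c (q, m) * if p = q then 1 else 0 := by
        intro q
        rw [← hr, Finset.mul_sum]
        exact Finset.sum_congr rfl fun _ _ => by ring
      simp_rw [this]
      simp
    rw [← Finset.mul_sum, h2, Finset.mul_sum, Finset.mul_sum, Finset.sum_div]
    exact Finset.sum_congr rfl fun _ _ => by ring
  · intro q
    calc 2 * s * (σ q.1 * d q.2) * (L ^ 2 * d q.2)
        = 2 * s * L ^ 2 * (σ q.1 * d q.2 ^ 2) := by ring
      _ ≤ 2 * s * L ^ 2 * (b ^ 2 * ‖Γ‖ ^ 2) := by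
        exact mul_le_mul_of_nonneg_left
          (mul_le_mul (hσb _) (hdsq _) (sq_nonneg _) (sq_nonneg _)) (by positivity)
      _ ≤ 1 / 2 := by linarith
  · refine ENNReal.ofReal_le_ofReal (Real.exp_le_exp.2 ?_)
    rw [Fintype.sum_prod_type]
    calc ∑ p, ∑ m, 2 * s * (σ p * d m) * (L ^ 2 * d m)
        = 2 * s * (L ^ 2 * (∑ m, d m ^ 2) * ∑ p, σ p) := by
          simp_rw [mul_assoc, Finset.sum_mul_sum, Finset.mul_sum]
          rw [Finset.sum_comm]
          exact Finset.sum_congr rfl fun _ _ => Finset.sum_congr rfl fun _ _ => by ring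
      _ ≤ _ := by
        rw [hσs]
        gcongr

/-- Exponential moments of `∑ i, ⟪Γ w i, w i⟫` for `w = B X`, where `X` has independent
sub-gaussian entries. -/
theorem expMoment_inner_apply_le [SFinite μ] {X : κ → Ω → H} (hX : ∀ i, Measurable (X i))
    (hind : iIndepFun X μ) {e : HilbertBasis ι ℝ H} {Γ : H →L[ℝ] H}
    (hΓ : IsPositiveTraceClass e Γ) {L : ℝ}
    (hsub : ∀ i z, expMoment μ (fun ω => ⟪z, X i ω⟫) ≤
      ENNReal.ofReal (Real.exp (L ^ 2 * ⟪Γ z, z⟫ / 2)))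
    (B : Matrix κ κ ℝ) {b s : ℝ}
    (hB : ∀ x : κ → ℝ, ∑ i, (∑ j, B i j * x j) ^ 2 ≤ b ^ 2 * ∑ j, x j ^ 2)
    (hs : 0 ≤ s) (hsb : s * (L ^ 2 * b ^ 2 * ‖Γ‖ ^ 2) ≤ 1 / 4) :
    expMoment μ (fun ω => s * ∑ i, ⟪Γ (∑ j, B i j • X j ω), ∑ j, B i j • X j ω⟫) ≤
      ENNReal.ofReal
        (Real.exp (2 * s * (L ^ 2 * hsNorm e Γ ^ 2 * ∑ i, ∑ j, B i j ^ 2))) := by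
  have : Countable ι := countable_of_hilbertBasis e
  -- The bound for compressions is uniform in `F`, so pointwise convergence and Fatou's lemma
  -- suffice.
  have hlim : ∀ ω, Filter.Tendsto (fun F : Finset ι => ENNReal.ofReal (Real.exp
      (s * ∑ i, ⟪Γ (∑ k ∈ F, ⟪e k, ∑ j, B i j • X j ω⟫ • e k),
        ∑ k ∈ F, ⟪e k, ∑ j, B i j • X j ω⟫ • e k⟫))) Filter.atTop
      (nhds (ENNReal.ofReal (Real.exp
        (s * ∑ i, ⟪Γ (∑ j, B i j • X j ω), ∑ j, B i j • X j ω⟫)))) := by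
    intro ω
    refine (ENNReal.continuous_ofReal.comp Real.continuous_exp).continuousAt.tendsto.comp ?_
    refine Filter.Tendsto.const_mul s (tendsto_finsetSum _ fun i _ => ?_)
    have h := e.hasSum_repr (∑ j, B i j • X j ω)
    simp_rw [e.repr_apply_apply] at h
    exact ((Γ.continuous.tendsto _).comp h).inner h
  calc expMoment μ (fun ω => s * ∑ i, ⟪Γ (∑ j, B i j • X j ω), ∑ j, B i j • X j ω⟫)
      = ∫⁻ ω, Filter.liminf (fun F : Finset ι => ENNReal.ofReal (Real.exp
      (s * ∑ i, ⟪Γ (∑ k ∈ F, ⟪e k, ∑ j, B i j • X j ω⟫ • e k),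
        ∑ k ∈ F, ⟪e k, ∑ j, B i j • X j ω⟫ • e k⟫))) Filter.atTop ∂μ :=
        lintegral_congr fun ω => (hlim ω).liminf_eq.symm
    _ ≤ Filter.liminf (fun F : Finset ι => expMoment μ fun ω =>
      (s * ∑ i, ⟪Γ (∑ k ∈ F, ⟪e k, ∑ j, B i j • X j ω⟫ • e k),
        ∑ k ∈ F, ⟪e k, ∑ j, B i j • X j ω⟫ • e k⟫)) Filter.atTop :=
        lintegral_liminf_le fun F => by fun_prop
    _ ≤ _ := Filter.liminf_le_of_le (by isBoundedDefault) fun c hc => by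
        obtain ⟨F, hF⟩ := hc.exists
        exact hF.trans (expMoment_compressed_le hX hind hΓ hsub B hB hs hsb F)

end QuadraticForms

/-! ### Decoupling of the off-diagonal part -/

section Decoupling

variable {Ω : Type*} [MeasurableSpace Ω] {μ : Measure Ω}

theorem expMoment_convexComb_le {τ : Type*} [Fintype τ] {w : τ → ℝ} (hw : ∀ i, 0 ≤ w i)
    (hw1 : ∑ i, w i = 1) {f : τ → Ω → ℝ} (hf : ∀ i, Measurable (f i)) {M : ℝ≥0∞}
    (hM : ∀ i, expMoment μ (f i) ≤ M) : expMoment μ (fun ω => ∑ i, w i * f i ω) ≤ M := by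
  calc expMoment μ (fun ω => ∑ i, w i * f i ω)
      ≤ ∫⁻ ω, ∑ i, ENNReal.ofReal (w i) * ENNReal.ofReal (Real.exp (f i ω)) ∂μ := by
        refine lintegral_mono fun ω => ?_
        have h := convexOn_exp.map_sum_le (t := Finset.univ) (w := w) (p := fun i => f i ω)
          (fun i _ => hw i) hw1 (fun _ _ => Set.mem_univ _)
        simp only [smul_eq_mul] at h
        refine (ENNReal.ofReal_le_ofReal h).trans_eq ?_
        rw [ENNReal.ofReal_sum_of_nonneg fun i _ => mul_nonneg (hw i) (Real.exp_pos _).le]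
        exact Finset.sum_congr rfl fun i _ => ENNReal.ofReal_mul (hw i)
    _ = ∑ i, ENNReal.ofReal (w i) * expMoment μ (f i) := by
        rw [lintegral_finsetSum _ fun i _ => by have := hf i; fun_prop]
        exact Finset.sum_congr rfl fun i _ => lintegral_const_mul _ (by have := hf i; fun_prop)
    _ ≤ ∑ i, ENNReal.ofReal (w i) * M := by
        gcongr with i
        exact hM i
    _ = M := by
        rw [← Finset.sum_mul, ← ENNReal.ofReal_sum_of_nonneg fun i _ => hw i, hw1]
        simp

theorem expMoment_indep_pair [IsFiniteMeasure μ] {β γ : Type*} [MeasurableSpace β]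
    [MeasurableSpace γ]
    {U : Ω → β} {V : Ω → γ} (hU : Measurable U) (hV : Measurable V) (hUV : IndepFun U V μ)
    {g : β → γ → ℝ} (hg : Measurable fun p : β × γ => g p.1 p.2) :
    expMoment μ (fun ω => g (U ω) (V ω)) =
      ∫⁻ ω', expMoment μ (fun ω => g (U ω) (V ω')) ∂μ := by
  have hG : Measurable fun p : β × γ => ENNReal.ofReal (Real.exp (g p.1 p.2)) := by fun_prop
  have h1 : expMoment μ (fun ω => g (U ω) (V ω)) =
      ∫⁻ p, ENNReal.ofReal (Real.exp (g p.1 p.2)) ∂(μ.map fun ω => (U ω, V ω)) :=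
    (lintegral_map hG (hU.prodMk hV)).symm
  rw [h1, hUV.map_prod_eq_prod_map_map hU.aemeasurable hV.aemeasurable,
    lintegral_prod_symm' _ hG, lintegral_map hG.lintegral_prod_left' hV]
  refine lintegral_congr fun ω' => ?_
  exact lintegral_map (f := fun x => ENNReal.ofReal (Real.exp (g x (V ω'))))
    (hG.comp (measurable_id.prodMk measurable_const)) hU

/-- Every off-diagonal sum is four times the average over `I` of its `I × Iᶜ` blocks. -/
theorem sum_offDiag_eq_average {κ : Type*} [Fintype κ] [DecidableEq κ] (T : κ → κ → ℝ) :
    ∑ i, ∑ j, (if i = j then 0 else T i j) =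
      ∑ I : Finset κ, (2 ^ Fintype.card κ : ℝ)⁻¹ *
        (4 * ∑ i, ∑ j, if i ∈ I ∧ j ∉ I then T i j else 0) := by
  simp_rw [Finset.mul_sum]
  rw [eq_comm, Finset.sum_comm]
  refine Finset.sum_congr rfl fun i _ => ?_
  rw [Finset.sum_comm]
  refine Finset.sum_congr rfl fun j _ => ?_
  simp_rw [← Finset.mul_sum, ← Finset.sum_filter, Finset.sum_const, nsmul_eq_mul]
  split_ifs with h
  · subst h
    simp
  -- Exactly a quarter of all subsets contain `i` and avoid `j`, whence the factor four; these
  -- subsets form an order interval.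
  · have h1 : (Finset.univ.filter fun I : Finset κ => i ∈ I ∧ j ∉ I) =
        Finset.Icc {i} (Finset.univ.erase j) := by
      ext I
      simp [Finset.subset_erase]
    have h2 : 2 ≤ Fintype.card κ := by
      have := Finset.card_le_univ ({i, j} : Finset κ)
      rwa [Finset.card_pair h] at this
    rw [h1, Finset.card_Icc_finset (by simp [h]), Finset.card_singleton,
      Finset.card_erase_of_mem (Finset.mem_univ _), Finset.card_univ]
    obtain ⟨m, hm⟩ := Nat.exists_eq_add_of_le h2
    rw [hm, show 2 + m - 1 - 1 = m by omega, pow_add]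
    push_cast
    field_simp
    norm_num

variable {κ ι H : Type*} [Fintype κ] [DecidableEq κ] [NormedAddCommGroup H]
  [InnerProductSpace ℝ H] [CompleteSpace H] [MeasurableSpace H] [BorelSpace H]
  [SecondCountableTopology H]

/-- The families indexed by `I` and `Iᶜ` are independent, so the second can be frozen and the first
integrated as a linear form. What remains is the quadratic form of `expMoment_inner_apply_le` with
`s = l ^ 2 * L ^ 2 / 2`. -/
theorem expMoment_block_le [IsFiniteMeasure μ] {X : κ → Ω → H} (hX : ∀ i, Measurable (X i))
    (hind : iIndepFun X μ) {e : HilbertBasis ι ℝ H} {Γ : H →L[ℝ] H}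
    (hΓ : IsPositiveTraceClass e Γ) {L : ℝ}
    (hsub : ∀ i z, expMoment μ (fun ω => ⟪z, X i ω⟫) ≤
      ENNReal.ofReal (Real.exp (L ^ 2 * ⟪Γ z, z⟫ / 2)))
    (A : Matrix κ κ ℝ) {a l : ℝ}
    (hA : ∀ x : κ → ℝ, ∑ i, (∑ j, A i j * x j) ^ 2 ≤ a ^ 2 * ∑ j, x j ^ 2)
    (hl : l ^ 2 * (L ^ 4 * a ^ 2 * ‖Γ‖ ^ 2) ≤ 1 / 2) (I : Finset κ) :
    expMoment μ (fun ω => l * ∑ i, ∑ j, if i ∈ I ∧ j ∉ I then A i j * ⟪X i ω, X j ω⟫ else 0) ≤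
      ENNReal.ofReal (Real.exp (l ^ 2 * (L ^ 4 * hsNorm e Γ ^ 2 * ∑ i, ∑ j, A i j ^ 2))) := by
  set B : Matrix κ κ ℝ := fun i j => if i ∈ I ∧ j ∉ I then A i j else 0 with hBdef
  have hB : ∀ x : κ → ℝ, ∑ i, (∑ j, B i j * x j) ^ 2 ≤ a ^ 2 * ∑ j, x j ^ 2 := by
    intro x
    -- Deleting columns amounts to masking `x`, and deleting rows drops nonnegative terms, so a
    -- block inherits the operator bound.
    calc ∑ i, (∑ j, B i j * x j) ^ 2 ≤ ∑ i, (∑ j, A i j * if j ∈ I then 0 else x j) ^ 2 := by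
          refine Finset.sum_le_sum fun i _ => ?_
          by_cases hi : i ∈ I
          · refine le_of_eq ?_
            congr 1
            refine Finset.sum_congr rfl fun j _ => ?_
            by_cases hj : j ∈ I <;> simp [hBdef, hi, hj]
          · simp only [hBdef, hi, false_and, if_false, zero_mul, Finset.sum_const_zero]
            rw [zero_pow two_ne_zero]
            positivity
      _ ≤ _ := hA _
      _ ≤ _ := by
          refine mul_le_mul_of_nonneg_left (Finset.sum_le_sum fun j _ => ?_) (sq_nonneg a)
          split_ifs
          · simpa using sq_nonneg (x j)
          · exact le_rfl
  have hBs : ∑ i, ∑ j, B i j ^ 2 ≤ ∑ i, ∑ j, A i j ^ 2 := by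
    refine Finset.sum_le_sum fun i _ => Finset.sum_le_sum fun j _ => ?_
    simp only [hBdef]
    split_ifs
    · exact le_rfl
    · simpa using sq_nonneg (A i j)
  set g : (I → H) → ((Iᶜ : Finset κ) → H) → ℝ := fun x y =>
    l * ∑ i, ∑ j, if h : i ∈ I ∧ j ∉ I then
      A i j * ⟪x ⟨i, h.1⟩, y ⟨j, Finset.mem_compl.2 h.2⟩⟫ else 0 with hg
  have hgm : Measurable fun p : (I → H) × ((Iᶜ : Finset κ) → H) => g p.1 p.2 := by
    refine Measurable.const_mul (Finset.measurable_sum _ fun i _ =>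
      Finset.measurable_sum _ fun j _ => ?_) _
    split_ifs
    · fun_prop
    · fun_prop
  have hindI := hind.indepFun_finset I Iᶜ disjoint_compl_right hX
  have h1 : ∀ ω, (l * ∑ i, ∑ j, if i ∈ I ∧ j ∉ I then A i j * ⟪X i ω, X j ω⟫ else 0) =
      g (fun i => X i ω) (fun j => X j ω) := by
    intro ω
    simp only [hg]
    congr 1
  have h2 : ∀ ω ω', g (fun i => X i ω) (fun j => X j ω') =
      ∑ i, ⟪l • ∑ j, B i j • X j ω', X i ω⟫ := by
    intro ω ω'
    simp only [hg, hBdef, real_inner_smul_left, sum_inner]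
    rw [Finset.mul_sum]
    refine Finset.sum_congr rfl fun i _ => ?_
    congr 1
    refine Finset.sum_congr rfl fun j _ => ?_
    split_ifs
    · rw [real_inner_comm]
    · simp
  rw [expMoment_congr h1, expMoment_indep_pair (measurable_pi_lambda _ fun i : I => hX i)
    (measurable_pi_lambda _ fun i : (Iᶜ : Finset κ) => hX i) hindI hgm]
  calc _ ≤ ∫⁻ ω', ENNReal.ofReal (Real.exp (l ^ 2 * L ^ 2 / 2 *
        ∑ i, ⟪Γ (∑ j, B i j • X j ω'), ∑ j, B i j • X j ω'⟫)) ∂μ := by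
        refine lintegral_mono fun ω' => ?_
        dsimp only
        rw [expMoment_congr fun ω => h2 ω ω']
        refine (expMoment_sum_inner_le hX hind hsub _).trans_eq ?_
        simp_rw [map_smul, real_inner_smul_left, real_inner_smul_right, ← Finset.mul_sum]
        congr 2
        ring
    _ ≤ _ := expMoment_inner_apply_le hX hind hΓ hsub B hB (by positivity) (by linarith)
    _ ≤ _ := by
        refine ENNReal.ofReal_le_ofReal (Real.exp_le_exp.2 ?_)
        calc _ = l ^ 2 * (L ^ 4 * hsNorm e Γ ^ 2 * ∑ i, ∑ j, B i j ^ 2) := by ring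
          _ ≤ _ := by gcongr

/-- Decoupling bound for the off-diagonal part of the quadratic form. -/
theorem expMoment_offDiag_le [IsFiniteMeasure μ] {X : κ → Ω → H} (hX : ∀ i, Measurable (X i))
    (hind : iIndepFun X μ) {e : HilbertBasis ι ℝ H} {Γ : H →L[ℝ] H}
    (hΓ : IsPositiveTraceClass e Γ) {L : ℝ}
    (hsub : ∀ i z, expMoment μ (fun ω => ⟪z, X i ω⟫) ≤
      ENNReal.ofReal (Real.exp (L ^ 2 * ⟪Γ z, z⟫ / 2)))
    (A : Matrix κ κ ℝ) {a l : ℝ}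
    (hA : ∀ x : κ → ℝ, ∑ i, (∑ j, A i j * x j) ^ 2 ≤ a ^ 2 * ∑ j, x j ^ 2)
    (hl : 16 * l ^ 2 * (L ^ 4 * a ^ 2 * ‖Γ‖ ^ 2) ≤ 1 / 2) :
    expMoment μ (fun ω => l * ∑ i, ∑ j, if i = j then 0 else A i j * ⟪X i ω, X j ω⟫) ≤
      ENNReal.ofReal
        (Real.exp (16 * l ^ 2 * (L ^ 4 * hsNorm e Γ ^ 2 * ∑ i, ∑ j, A i j ^ 2))) := by
  have h1 : ∀ ω, (l * ∑ i, ∑ j, if i = j then 0 else A i j * ⟪X i ω, X j ω⟫) =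
      ∑ I : Finset κ, (2 ^ Fintype.card κ : ℝ)⁻¹ *
        ((4 * l) * ∑ i, ∑ j, if i ∈ I ∧ j ∉ I then A i j * ⟪X i ω, X j ω⟫ else 0) := by
    intro ω
    rw [sum_offDiag_eq_average, Finset.mul_sum]
    exact Finset.sum_congr rfl fun I _ => by ring
  rw [expMoment_congr h1]
  refine expMoment_convexComb_le (fun _ => by positivity) (by simp) (fun I => ?_) fun I => ?_
  · refine Measurable.const_mul (Finset.measurable_sum _ fun i _ =>
      Finset.measurable_sum _ fun j _ => ?_) _
    have := hX i
    have := hX j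
    split_ifs <;> fun_prop
  · refine (expMoment_block_le hX hind hΓ hsub A (l := 4 * l) hA (by linarith) I).trans_eq ?_
    congr 3
    ring

end Decoupling

/-! ### Exponential moments from Bernstein's condition -/

section Bernstein

variable {Ω : Type*} [MeasurableSpace Ω] {μ : Measure Ω} [IsProbabilityMeasure μ]

theorem hasSum_exp_tail (y : ℝ) :
    HasSum (fun m : ℕ => y ^ (m + 2) / (m + 2)!) (Real.exp y - 1 - y) := by
  have h := NormedSpace.expSeries_div_hasSum_exp y
  rw [← Real.exp_eq_exp_ℝ] at h
  have h2 := (hasSum_nat_add_iff' 2).2 h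
  simpa [Finset.sum_range_succ, sub_sub] using h2

theorem exp_sub_le_exp_abs_sub (y : ℝ) :
    Real.exp y - 1 - y ≤ Real.exp |y| - 1 - |y| :=
  hasSum_le (fun m => by
    gcongr ?_ / _
    rw [← abs_pow]
    exact le_abs_self _) (hasSum_exp_tail y) (hasSum_exp_tail |y|)

/-- The mean kills the linear term of the exponential series. The factorials cancel in the rest,
leaving a geometric series of ratio `|x| * b ≤ 1 / 2`. -/
theorem expMoment_le_of_moments {Y : Ω → ℝ} (hY : Measurable Y) (hYi : Integrable Y μ)
    (hY0 : ∫ ω, Y ω ∂μ = 0) {D b V : ℝ} (hD : 0 ≤ D) (hb : 0 ≤ b)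
    (hint : ∀ k : ℕ, 2 ≤ k → Integrable (fun ω => |Y ω| ^ k) μ)
    (hmom : ∀ k : ℕ, 2 ≤ k → ∫ ω, |Y ω| ^ k ∂μ ≤ D * (k ! : ℝ) * b ^ (k - 2) * V ^ 2)
    {x : ℝ} (hx : |x| * b ≤ 1 / 2) :
    expMoment μ (fun ω => x * Y ω) ≤ ENNReal.ofReal (Real.exp (2 * D * (x ^ 2 * V ^ 2))) := by
  have hterm : ∀ m : ℕ, ∫⁻ ω, ENNReal.ofReal (|x * Y ω| ^ (m + 2) / (m + 2)!) ∂μ ≤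
      ENNReal.ofReal (D * (x ^ 2 * V ^ 2) * (1 / 2) ^ m) := by
    intro m
    have h1 : ∀ ω, |x * Y ω| ^ (m + 2) / (m + 2)! =
        (|x| ^ (m + 2) / (m + 2)!) * |Y ω| ^ (m + 2) := by
      intro ω
      rw [abs_mul, mul_pow]
      ring
    simp_rw [h1]
    rw [← ofReal_integral_eq_lintegral_ofReal ((hint (m + 2) (by omega)).const_mul _)
      (Filter.Eventually.of_forall fun ω => by positivity), integral_const_mul]
    refine ENNReal.ofReal_le_ofReal ?_
    have hf : (0 : ℝ) < ((m + 2)! : ℝ) := by positivity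
    calc _ ≤ (|x| ^ (m + 2) / (m + 2)!) * (D * ((m + 2)! : ℝ) * b ^ (m + 2 - 2) * V ^ 2) := by
          gcongr
          exact hmom (m + 2) (by omega)
      _ = D * (|x| ^ 2 * V ^ 2) * (|x| * b) ^ m := by
          rw [Nat.add_sub_cancel, mul_pow, pow_add]
          field_simp
      _ ≤ _ := by
          rw [sq_abs]
          gcongr
  have htail : ∫⁻ ω, ENNReal.ofReal (Real.exp |x * Y ω| - 1 - |x * Y ω|) ∂μ ≤
      ENNReal.ofReal (2 * D * (x ^ 2 * V ^ 2)) := by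
    have h1 : ∀ ω, ENNReal.ofReal (Real.exp |x * Y ω| - 1 - |x * Y ω|) =
        ∑' m : ℕ, ENNReal.ofReal (|x * Y ω| ^ (m + 2) / (m + 2)!) := by
      intro ω
      rw [← (hasSum_exp_tail |x * Y ω|).tsum_eq]
      exact ENNReal.ofReal_tsum_of_nonneg (fun _ => by positivity)
        (hasSum_exp_tail |x * Y ω|).summable
    simp_rw [h1]
    rw [lintegral_tsum fun m => by fun_prop]
    refine (ENNReal.tsum_le_tsum hterm).trans ?_
    rw [← ENNReal.ofReal_tsum_of_nonneg (fun _ => by positivity)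
      (summable_geometric_two.mul_left _), tsum_mul_left, tsum_geometric_two]
    exact ENNReal.ofReal_le_ofReal (by linarith)
  have hnn : ∀ ω, 0 ≤ Real.exp |x * Y ω| - 1 - |x * Y ω| := fun ω => by
    linarith [Real.add_one_le_exp |x * Y ω|]
  have hti : Integrable (fun ω => Real.exp |x * Y ω| - 1 - |x * Y ω|) μ := by
    refine ⟨by fun_prop, ?_⟩
    rw [hasFiniteIntegral_iff_ofReal (Filter.Eventually.of_forall hnn)]
    exact htail.trans_lt ENNReal.ofReal_lt_top
  have htle : ∫ ω, (Real.exp |x * Y ω| - 1 - |x * Y ω|) ∂μ ≤ 2 * D * (x ^ 2 * V ^ 2) := by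
    rw [← ENNReal.ofReal_le_ofReal_iff (by positivity),
      ofReal_integral_eq_lintegral_ofReal hti (Filter.Eventually.of_forall hnn)]
    exact htail
  have hsum : Integrable (fun ω => (1 + x * Y ω) + (Real.exp |x * Y ω| - 1 - |x * Y ω|)) μ :=
    ((integrable_const 1).add (hYi.const_mul x)).add hti
  have hle : ∀ ω, Real.exp (x * Y ω) ≤
      (1 + x * Y ω) + (Real.exp |x * Y ω| - 1 - |x * Y ω|) := fun ω => by
    linarith [exp_sub_le_exp_abs_sub (x * Y ω)]
  calc expMoment μ (fun ω => x * Y ω)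
      ≤ ∫⁻ ω, ENNReal.ofReal ((1 + x * Y ω) + (Real.exp |x * Y ω| - 1 - |x * Y ω|)) ∂μ :=
        lintegral_mono fun ω => ENNReal.ofReal_le_ofReal (hle ω)
    _ = ENNReal.ofReal (∫ ω, ((1 + x * Y ω) + (Real.exp |x * Y ω| - 1 - |x * Y ω|)) ∂μ) :=
        (ofReal_integral_eq_lintegral_ofReal hsum (Filter.Eventually.of_forall fun ω =>
          (Real.exp_pos _).le.trans (hle ω))).symm
    _ ≤ _ := by
        refine ENNReal.ofReal_le_ofReal ?_
        have hlin : Integrable (fun ω => 1 + x * Y ω) μ :=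
          (integrable_const 1).add (hYi.const_mul x)
        rw [integral_add hlin hti, integral_add (integrable_const 1) (hYi.const_mul x),
          integral_const_mul, hY0]
        simp only [integral_const, probReal_univ, one_smul, mul_zero, add_zero]
        linarith [Real.add_one_le_exp (2 * D * (x ^ 2 * V ^ 2))]

/-- Bernstein's moment condition from order three on bounds the variance by interpolation. -/
theorem expMoment_le_of_bernstein {Y : Ω → ℝ} (hY : Measurable Y) (hYi : Integrable Y μ)
    (hY0 : ∫ ω, Y ω ∂μ = 0) {C₀ b V : ℝ} (hC : 0 ≤ C₀) (hb : 0 ≤ b) (hV : 0 < V) (hbV : b ≤ V)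
    (hint : ∀ k : ℕ, 3 ≤ k → Integrable (fun ω => |Y ω| ^ k) μ)
    (hmom : ∀ k : ℕ, 3 ≤ k → ∫ ω, |Y ω| ^ k ∂μ ≤ C₀ * (k ! : ℝ) * b ^ (k - 2) * V ^ 2)
    {x : ℝ} (hx : |x| * b ≤ 1 / 2) :
    expMoment μ (fun ω => x * Y ω) ≤
      ENNReal.ofReal (Real.exp ((1 + 24 * C₀) * (x ^ 2 * V ^ 2))) := by
  -- No second moment is assumed: it is interpolated between a constant and the fourth moment. Since
  -- `b ≤ V`, the latter is at most `4! * C₀ * V ^ 4`, which is the source of `24 * C₀`.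
  have hpt : ∀ ω, |Y ω| ^ 2 ≤ (V ^ 2 + |Y ω| ^ 4 / V ^ 2) / 2 := by
    intro ω
    have h : 0 ≤ (V - |Y ω| ^ 2 / V) ^ 2 := sq_nonneg _
    have h2 : (V - |Y ω| ^ 2 / V) ^ 2 = V ^ 2 + |Y ω| ^ 4 / V ^ 2 - 2 * |Y ω| ^ 2 := by
      field_simp
      ring
    linarith
  have hbound : Integrable (fun ω => (V ^ 2 + |Y ω| ^ 4 / V ^ 2) / 2) μ :=
    ((integrable_const _).add ((hint 4 (by norm_num)).div_const _)).div_const _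
  have h2i : Integrable (fun ω => |Y ω| ^ 2) μ :=
    hbound.mono' (by fun_prop) (Filter.Eventually.of_forall fun ω => by
      rw [Real.norm_of_nonneg (by positivity)]; exact hpt ω)
  have h2le : ∫ ω, |Y ω| ^ 2 ∂μ ≤ (1 + 24 * C₀) / 2 * V ^ 2 := by
    refine (integral_mono h2i hbound hpt).trans ?_
    rw [integral_div, integral_add (integrable_const _) ((hint 4 (by norm_num)).div_const _),
      integral_div]
    simp only [integral_const, probReal_univ, one_smul]
    have h4 := hmom 4 (by norm_num)
    have h5 : (∫ ω, |Y ω| ^ 4 ∂μ) / V ^ 2 ≤ 24 * C₀ * V ^ 2 := by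
      rw [div_le_iff₀ (by positivity)]
      calc _ ≤ C₀ * ((4 ! : ℕ) : ℝ) * b ^ (4 - 2) * V ^ 2 := h4
        _ ≤ C₀ * ((4 ! : ℕ) : ℝ) * V ^ (4 - 2) * V ^ 2 := by gcongr
        _ = _ := by
          norm_num [Nat.factorial]
          left
          ring
    linarith
  have hsplit : ∀ k : ℕ, 2 ≤ k → k = 2 ∨ 3 ≤ k := fun k hk => by omega
  refine (expMoment_le_of_moments hY hYi hY0 (D := (1 + 24 * C₀) / 2) (V := V) (by positivity) hb
    (fun k hk => ?_) (fun k hk => ?_) hx).trans_eq (by congr 2; ring)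
  · rcases hsplit k hk with rfl | h3
    · exact h2i
    · exact hint k h3
  · rcases hsplit k hk with rfl | h3
    · refine h2le.trans ?_
      have : 0 ≤ (1 + 24 * C₀) / 2 * V ^ 2 := by positivity
      simp [Nat.factorial]
      nlinarith
    · refine (hmom k h3).trans ?_
      gcongr
      linarith

end Bernstein

/-! ### Sub-gaussian norm and covariance operator -/

section Covariance

variable {ι H Ω : Type*} [NormedAddCommGroup H] [InnerProductSpace ℝ H] [CompleteSpace H]
  [MeasurableSpace Ω] {μ : Measure Ω}

theorem psi2Norm_nonneg (Γ : H →L[ℝ] H) (Z : Ω → H) (μ : Measure Ω) : 0 ≤ psi2Norm Γ Z μ :=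
  Real.sInf_nonneg fun _ h => h.1

/-- The infimum defining the sub-gaussian norm is attained. -/
theorem IsSubgaussian.bound_of_psi2Norm_le {Γ : H →L[ℝ] H} (hΓ : Γ.IsPositive) {Z : Ω → H}
    (hZ : IsSubgaussian Γ Z μ) {L : ℝ} (hL : psi2Norm Γ Z μ ≤ L) : SubgaussianBound Γ Z μ L := by
  obtain ⟨-, α₀, h0, hα₀⟩ := hZ
  intro z
  refine ⟨(hα₀ z).1, ?_⟩
  have hcont : Filter.Tendsto (fun β : ℝ => Real.exp (β ^ 2 * ⟪Γ z, z⟫ / 2))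
      (nhdsWithin L (Set.Ioi L)) (nhds (Real.exp (L ^ 2 * ⟪Γ z, z⟫ / 2))) :=
    (Continuous.tendsto (by fun_prop) L).mono_left nhdsWithin_le_nhds
  -- Every `β > L` exceeds some admissible `α`, hence satisfies the bound; let `β` decrease to `L`.
  refine ge_of_tendsto hcont (eventually_nhdsWithin_of_forall fun β hβ => ?_)
  obtain ⟨α, ⟨hα0, hα⟩, hαβ⟩ := exists_lt_of_csInf_lt (s := {α : ℝ | 0 ≤ α ∧
    SubgaussianBound Γ Z μ α}) ⟨α₀, h0, hα₀⟩ (lt_of_le_of_lt hL hβ)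
  refine (hα z).2.trans (Real.exp_le_exp.2 ?_)
  have := hΓ.inner_nonneg_left z
  gcongr

theorem SubgaussianBound.expMoment_le {Γ : H →L[ℝ] H} {Z : Ω → H} {L : ℝ}
    (hZ : SubgaussianBound Γ Z μ L) (h0 : ∫ ω, Z ω ∂μ = 0) (z : H) :
    expMoment μ (fun ω => ⟪z, Z ω⟫) ≤ ENNReal.ofReal (Real.exp (L ^ 2 * ⟪Γ z, z⟫ / 2)) := by
  have h := hZ z
  simp only [h0, sub_zero] at h
  rw [expMoment, ← ofReal_integral_eq_lintegral_ofReal h.1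
    (Filter.Eventually.of_forall fun _ => (Real.exp_pos _).le)]
  exact ENNReal.ofReal_le_ofReal h.2

theorem one_add_sq_le_cosh (y : ℝ) : 1 + y ^ 2 / 2 ≤ Real.cosh y := by
  have h1 : Real.cosh y = 1 + 2 * Real.sinh (y / 2) ^ 2 := by
    have h := Real.cosh_two_mul (y / 2)
    rw [Real.cosh_sq, mul_div_cancel₀ y two_ne_zero] at h
    linarith
  have h2 : (y / 2) ^ 2 ≤ Real.sinh (y / 2) ^ 2 := by
    rcases le_total 0 (y / 2) with h | h
    · have := Real.self_le_sinh_iff.2 h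
      gcongr
    · have := Real.sinh_le_self_iff.2 h
      nlinarith
  rw [h1]
  nlinarith

/-- Compare second-order terms at `s = 0` in the bounds for `s • z` and `-s • z`: their average
dominates `1 + s² ⟪z, Z⟫² / 2` through `cosh`. Divide by `s² / 2` and let `s` tend to `0`. -/
theorem SubgaussianBound.integral_inner_sq_le [IsProbabilityMeasure μ] {Γ : H →L[ℝ] H}
    {Z : Ω → H} {L : ℝ} (hZ : SubgaussianBound Γ Z μ L) (h0 : ∫ ω, Z ω ∂μ = 0)
    (hZ2 : MemLp Z 2 μ) (z : H) : ∫ ω, ⟪z, Z ω⟫ ^ 2 ∂μ ≤ L ^ 2 * ⟪Γ z, z⟫ := by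
  have hZ' : ∀ z, Integrable (fun ω => Real.exp ⟪z, Z ω⟫) μ ∧
      ∫ ω, Real.exp ⟪z, Z ω⟫ ∂μ ≤ Real.exp (L ^ 2 * ⟪Γ z, z⟫ / 2) := by
    intro z
    have h := hZ z
    simpa only [h0, sub_zero] using h
  set v := L ^ 2 * ⟪Γ z, z⟫ with hv
  set E := ∫ ω, ⟪z, Z ω⟫ ^ 2 ∂μ with hE
  have hi : Integrable (fun ω => ⟪z, Z ω⟫ ^ 2) μ := (hZ2.const_inner z).integrable_sq
  have key : ∀ s : ℝ, 0 < s → E ≤ v * Real.exp (s ^ 2 * v / 2) := by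
    intro s hs
    have hform : ∀ r : ℝ, L ^ 2 * ⟪Γ (r • z), r • z⟫ / 2 = r ^ 2 * v / 2 := by
      intro r
      rw [map_smul, real_inner_smul_left, real_inner_smul_right, hv]
      ring
    have h1 := hZ' (s • z)
    have h2 := hZ' ((-s) • z)
    rw [hform] at h1 h2
    have h3 : ∫ ω, (1 + s ^ 2 / 2 * ⟪z, Z ω⟫ ^ 2) ∂μ ≤
        ∫ ω, (Real.exp ⟪s • z, Z ω⟫ + Real.exp ⟪(-s) • z, Z ω⟫) / 2 ∂μ := by
      refine integral_mono ((integrable_const _).add (hi.const_mul _))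
        ((h1.1.add h2.1).div_const 2) fun ω => ?_
      have := one_add_sq_le_cosh (s * ⟪z, Z ω⟫)
      rw [Real.cosh_eq] at this
      simp only [real_inner_smul_left, neg_mul]
      calc _ = 1 + (s * ⟪z, Z ω⟫) ^ 2 / 2 := by ring
        _ ≤ _ := this
    rw [integral_add (integrable_const _) (hi.const_mul _), integral_const_mul, integral_div,
      integral_add h1.1 h2.1] at h3
    simp only [integral_const, probReal_univ, one_smul, neg_sq] at h3 h2
    have h4 : s ^ 2 / 2 * E ≤ Real.exp (s ^ 2 * v / 2) - 1 := by linarith [h1.2, h2.2]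
    have h5 : Real.exp (s ^ 2 * v / 2) - 1 ≤ s ^ 2 * v / 2 * Real.exp (s ^ 2 * v / 2) := by
      have := Real.add_one_le_exp (-(s ^ 2 * v / 2))
      have h6 : Real.exp (s ^ 2 * v / 2) * Real.exp (-(s ^ 2 * v / 2)) = 1 := by
        rw [← Real.exp_add]; simp
      nlinarith [Real.exp_pos (s ^ 2 * v / 2)]
    have h7 : s ^ 2 / 2 * E ≤ s ^ 2 / 2 * (v * Real.exp (s ^ 2 * v / 2)) := by
      linarith
    exact le_of_mul_le_mul_left h7 (by positivity)
  have hcont : Filter.Tendsto (fun s : ℝ => v * Real.exp (s ^ 2 * v / 2))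
      (nhdsWithin 0 (Set.Ioi 0)) (nhds (v * Real.exp ((0 : ℝ) ^ 2 * v / 2))) :=
    (Continuous.tendsto (by fun_prop) 0).mono_left nhdsWithin_le_nhds
  have := ge_of_tendsto hcont (eventually_nhdsWithin_of_forall fun s hs => key s hs)
  simpa using this

variable [MeasurableSpace H] [BorelSpace H] [SecondCountableTopology H]

theorem covarianceOperator_map_inner {Z : Ω → H} (hZm : Measurable Z) (hZ2 : MemLp Z 2 μ)
    (x y : H) : ⟪covarianceOperator (μ.map Z) x, y⟫ = ∫ ω, ⟪x, Z ω⟫ * ⟪y, Z ω⟫ ∂μ := by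
  rw [covarianceOperator_inner
    ((memLp_map_measure_iff (by fun_prop) hZm.aemeasurable).2 (by simpa using hZ2)),
    integral_map hZm.aemeasurable (by fun_prop)]

/-- The trace of `Σ T` is `E ⟪Z, T Z⟫`. -/
theorem hasSum_inner_covarianceOperator (e : HilbertBasis ι ℝ H) {Z : Ω → H}
    (hZm : Measurable Z) (hZ2 : MemLp Z 2 μ) {T : H →L[ℝ] H}
    (hT : ∀ x y, ⟪T x, y⟫ = ⟪x, T y⟫) :
    HasSum (fun j => ⟪covarianceOperator (μ.map Z) (e j), T (e j)⟫)
      (∫ ω, ⟪Z ω, T (Z ω)⟫ ∂μ) := by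
  have : Countable ι := countable_of_hilbertBasis e
  simp_rw [covarianceOperator_map_inner hZm hZ2]
  have hb : ∀ ω, HasSum (fun j => (⟪e j, Z ω⟫ ^ 2 + ⟪e j, T (Z ω)⟫ ^ 2) / 2)
      ((‖Z ω‖ ^ 2 + ‖T (Z ω)‖ ^ 2) / 2) := fun ω =>
    ((hasSum_inner_sq e (Z ω)).add (hasSum_inner_sq e (T (Z ω)))).div_const 2
  refine hasSum_integral_of_dominated_convergence
    (fun j ω => (⟪e j, Z ω⟫ ^ 2 + ⟪e j, T (Z ω)⟫ ^ 2) / 2) (fun j => ?_) (fun j => ?_)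
    (Filter.Eventually.of_forall fun ω => (hb ω).summable) ?_ ?_
  · exact Measurable.aestronglyMeasurable (by fun_prop)
  · refine Filter.Eventually.of_forall fun ω => ?_
    rw [hT, Real.norm_eq_abs, abs_mul, ← sq_abs ⟪e j, Z ω⟫, ← sq_abs ⟪e j, T (Z ω)⟫]
    nlinarith [sq_nonneg (|⟪e j, Z ω⟫| - |⟪e j, T (Z ω)⟫|)]
  · simp_rw [fun ω => (hb ω).tsum_eq]
    have h1 : Integrable (fun ω => ‖Z ω‖ ^ 2) μ :=
      (memLp_two_iff_integrable_sq_norm hZ2.1).1 hZ2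
    have h2 : Integrable (fun ω => ‖T (Z ω)‖ ^ 2) μ :=
      (memLp_two_iff_integrable_sq_norm (T.comp_memLp' hZ2).1).1 (T.comp_memLp' hZ2)
    exact (h1.add h2).div_const 2
  · refine Filter.Eventually.of_forall fun ω => ?_
    simp_rw [hT, real_inner_comm (Z ω) (e _)]
    exact e.hasSum_inner_mul_inner (Z ω) (T (Z ω))

/-- Operator domination `Σ ≤ c Γ` of the covariance operator passes to Hilbert-Schmidt norms. -/
theorem hsNorm_covarianceOperator_le {e : HilbertBasis ι ℝ H} {Γ : H →L[ℝ] H}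
    (hΓ : IsPositiveTraceClass e Γ) {Z : Ω → H} (hZm : Measurable Z) (hZ2 : MemLp Z 2 μ)
    {c : ℝ} (hc : 0 ≤ c) (hle : ∀ z, ∫ ω, ⟪z, Z ω⟫ ^ 2 ∂μ ≤ c * ⟪Γ z, z⟫) :
    hsNorm e (covarianceOperator (μ.map Z)) ≤ c * hsNorm e Γ := by
  set S := covarianceOperator (μ.map Z) with hS
  have hSs : ∀ x y, ⟪S x, y⟫ = ⟪x, S y⟫ := by
    intro x y
    rw [real_inner_comm _ x, hS, covarianceOperator_map_inner hZm hZ2,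
      covarianceOperator_map_inner hZm hZ2]
    exact integral_congr_ae (Filter.Eventually.of_forall fun ω => mul_comm _ _)
  have h1 := hasSum_inner_covarianceOperator e hZm hZ2 hSs
  have h2 := hasSum_inner_covarianceOperator e hZm hZ2
    (T := Γ) (fun x y => hΓ.1.isSymmetric x y)
  rw [← hS] at h1 h2
  simp only [real_inner_self_eq_norm_sq] at h1
  have hint : ∀ T : H →L[ℝ] H, Integrable (fun ω => ⟪Z ω, T (Z ω)⟫) μ := by
    intro T
    have h : Integrable (fun ω => ‖Z ω‖ ^ 2) μ := (memLp_two_iff_integrable_sq_norm hZ2.1).1 hZ2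
    refine (h.const_mul ‖T‖).mono' (Measurable.aestronglyMeasurable (by fun_prop))
      (Filter.Eventually.of_forall fun ω => ?_)
    calc _ ≤ ‖Z ω‖ * ‖T (Z ω)‖ := norm_inner_le_norm _ _
      _ ≤ ‖Z ω‖ * (‖T‖ * ‖Z ω‖) := by gcongr; exact T.le_opNorm _
      _ = _ := by ring
  -- Applying `S ≤ c Γ` at the random vector `Z` and integrating gives `tr S² ≤ c tr (S Γ)`.
  -- Termwise `2 c ⟪S e, Γ e⟫ ≤ ‖S e‖² + c² ‖Γ e‖²` then absorbs half of the left side.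
  have h3 : ∫ ω, ⟪Z ω, S (Z ω)⟫ ∂μ ≤ c * ∫ ω, ⟪Z ω, Γ (Z ω)⟫ ∂μ := by
    rw [← integral_const_mul]
    refine integral_mono (hint S) ((hint Γ).const_mul c) fun ω => ?_
    have h := hle (Z ω)
    dsimp only
    rw [← hSs, hS, covarianceOperator_map_inner hZm hZ2, real_inner_comm _ (Z ω)]
    simpa only [pow_two] using h
  have hG := summable_norm_sq hΓ
  have h4 : c * ∫ ω, ⟪Z ω, Γ (Z ω)⟫ ∂μ ≤
      ((∫ ω, ⟪Z ω, S (Z ω)⟫ ∂μ) + c ^ 2 * ∑' j, ‖Γ (e j)‖ ^ 2) / 2 := by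
    refine hasSum_le (fun j => ?_) (h2.mul_left c)
      ((h1.add (hG.hasSum.mul_left (c ^ 2))).div_const 2)
    have h5 := real_inner_le_norm (S (e j)) (Γ (e j))
    nlinarith [sq_nonneg (‖S (e j)‖ - c * ‖Γ (e j)‖)]
  refine le_of_sq_le_sq ?_ (mul_nonneg hc (Real.sqrt_nonneg _))
  rw [mul_pow, hsNorm_sq, hsNorm_sq, h1.tsum_eq]
  linarith

end Covariance

/-! ### Chernoff bound -/

section Tail

variable {Ω : Type*} [MeasurableSpace Ω] {μ : Measure Ω} [IsProbabilityMeasure μ]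

theorem measureReal_le_of_expMoment_le {f : Ω → ℝ} (hf : Measurable f) {l t M : ℝ}
    (hl : 0 < l) (h : expMoment μ (fun ω => l * f ω) ≤ ENNReal.ofReal (Real.exp M)) :
    μ.real {ω | t ≤ f ω} ≤ Real.exp (M - l * t) := by
  have h1 := mul_meas_ge_le_lintegral₀ (μ := μ)
    (f := fun ω => ENNReal.ofReal (Real.exp (l * f ω))) (by fun_prop)
    (ENNReal.ofReal (Real.exp (l * t)))
  have h2 : {ω | t ≤ f ω} =
      {ω | ENNReal.ofReal (Real.exp (l * t)) ≤ ENNReal.ofReal (Real.exp (l * f ω))} := by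
    ext ω
    simp only [Set.mem_ofPred_eq]
    rw [ENNReal.ofReal_le_ofReal_iff (Real.exp_pos _).le, Real.exp_le_exp,
      mul_le_mul_iff_right₀ hl]
  rw [← h2] at h1
  have h3 := ENNReal.toReal_mono ENNReal.ofReal_ne_top (h1.trans h)
  rw [ENNReal.toReal_mul, ENNReal.toReal_ofReal (Real.exp_pos _).le,
    ENNReal.toReal_ofReal (Real.exp_pos _).le] at h3
  rw [Real.exp_sub, le_div_iff₀ (Real.exp_pos _), mul_comm]
  exact h3

/-- Chernoff's bound for a variable with Gaussian exponential moments on an interval. -/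
theorem measureReal_abs_ge_le {f : Ω → ℝ} (hf : Measurable f) {K r v β : ℝ} (hK : 0 < K)
    (hr : 0 < r) (hv : 0 < v) (hβ : 0 < β)
    (h : ∀ l : ℝ, |l| * β ≤ r →
      expMoment μ (fun ω => l * f ω) ≤ ENNReal.ofReal (Real.exp (K * l ^ 2 * v)))
    {t : ℝ} (ht : 0 < t) :
    μ.real {ω | t ≤ |f ω|} ≤
      2 * Real.exp (-(min (1 / (4 * K)) (r / 2)) * min (t ^ 2 / v) (t / β)) := by
  -- The unconstrained minimiser of `K * l ^ 2 * v - l * t`, capped at the end of the admissible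
  -- range; either way the exponent is at most `-(l * t / 2)`.
  set l := min (t / (2 * K * v)) (r / β) with hl
  have hl0 : 0 < l := lt_min (by positivity) (by positivity)
  have hlβ : |l| * β ≤ r := by
    rw [abs_of_pos hl0, ← le_div_iff₀ hβ]
    exact min_le_right _ _
  have hexp : K * l ^ 2 * v - l * t ≤
      -(min (1 / (4 * K)) (r / 2)) * min (t ^ 2 / v) (t / β) := by
    have h1 : l * (2 * K * v) ≤ t := by
      rw [← le_div_iff₀ (by positivity)]
      exact min_le_left _ _
    have h2 : K * l ^ 2 * v - l * t ≤ -(l * t / 2) := by nlinarith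
    refine h2.trans ?_
    rw [neg_mul, neg_le_neg_iff]
    have hm : 0 ≤ min (1 / (4 * K)) (r / 2) := le_min (by positivity) (by positivity)
    rcases min_choice (t / (2 * K * v)) (r / β) with h3 | h3
    · rw [hl, h3]
      calc _ ≤ 1 / (4 * K) * (t ^ 2 / v) := by
            gcongr
            · exact min_le_left _ _
            · exact min_le_left _ _
        _ = _ := by field_simp; norm_num
    · rw [hl, h3]
      calc _ ≤ r / 2 * (t / β) := by
            gcongr
            · exact min_le_right _ _
            · exact min_le_right _ _
        _ = _ := by field_simp
  have hpos := measureReal_le_of_expMoment_le (t := t) hf hl0 (h l hlβ)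
  have hneg := measureReal_le_of_expMoment_le (t := t) (f := fun ω => -f ω) hf.neg hl0
    (M := K * l ^ 2 * v) (by
      have h1 := h (-l) (by rwa [abs_neg])
      simpa only [neg_mul, mul_neg, neg_sq] using h1)
  have hsub : {ω | t ≤ |f ω|} ⊆ {ω | t ≤ f ω} ∪ {ω | t ≤ -f ω} := by
    intro ω hω
    rw [Set.mem_ofPred_eq] at hω
    rw [Set.mem_union, Set.mem_ofPred_eq, Set.mem_ofPred_eq]
    exact le_abs.1 hω
  calc μ.real {ω | t ≤ |f ω|} ≤ μ.real {ω | t ≤ f ω} + μ.real {ω | t ≤ -f ω} :=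
        (measureReal_mono hsub).trans (measureReal_union_le _ _)
    _ ≤ 2 * Real.exp (K * l ^ 2 * v - l * t) := by linarith
    _ ≤ _ := by gcongr

end Tail

/-! ### Matrix norms -/

section MatrixNorms

variable {n : ℕ} (A : Matrix (Fin n) (Fin n) ℝ)

theorem matHSNorm_sq : matHSNorm A ^ 2 = ∑ i, ∑ j, A i j ^ 2 :=
  Real.sq_sqrt (by positivity)

theorem sum_sq_mulVec_le (x : Fin n → ℝ) :
    ∑ i, (∑ j, A i j * x j) ^ 2 ≤ matOpNorm A ^ 2 * ∑ j, x j ^ 2 := by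
  have h := (Matrix.toEuclideanCLM (n := Fin n) (𝕜 := ℝ) A).le_opNorm (WithLp.toLp 2 x)
  have h2 := pow_le_pow_left₀ (norm_nonneg _) h 2
  rw [mul_pow, EuclideanSpace.real_norm_sq_eq, EuclideanSpace.real_norm_sq_eq] at h2
  simpa [matOpNorm, Matrix.mulVec, dotProduct] using h2

theorem matOpNorm_nonneg : 0 ≤ matOpNorm A := norm_nonneg _

theorem abs_apply_le_matOpNorm (i j : Fin n) : |A i j| ≤ matOpNorm A := by
  have h := sum_sq_mulVec_le A (Pi.single j 1)
  simp only [Pi.single_apply, mul_ite, mul_one, mul_zero, Finset.sum_ite_eq', Finset.mem_univ,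
    if_true, ite_pow, one_pow, ne_eq, OfNat.ofNat_ne_zero, not_false_eq_true, zero_pow] at h
  refine abs_le_of_sq_le_sq ?_ (matOpNorm_nonneg A)
  exact (Finset.single_le_sum (f := fun i => A i j ^ 2) (fun _ _ => sq_nonneg _)
    (Finset.mem_univ i)).trans h

theorem matHSNorm_pos (h : 0 < matOpNorm A) : 0 < matHSNorm A := by
  refine (Real.sqrt_nonneg _).lt_of_ne' fun h0 => h.ne' ?_
  have h1 : ∑ i, ∑ j, A i j ^ 2 = 0 := by rw [← matHSNorm_sq]; rw [matHSNorm, h0]; norm_num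
  have h2 : A = 0 := by
    ext i j
    have h3 := (Finset.sum_eq_zero_iff_of_nonneg fun i _ => by positivity).1 h1 i
      (Finset.mem_univ i)
    have h4 := (Finset.sum_eq_zero_iff_of_nonneg fun i _ => by positivity).1 h3 j
      (Finset.mem_univ j)
    simpa using h4
  simp [matOpNorm, h2]

end MatrixNorms

/-! ### Exponential moment of the quadratic form and the degenerate case -/

section Main

variable {ι H Ω : Type*} [NormedAddCommGroup H] [InnerProductSpace ℝ H] [CompleteSpace H]
  [MeasurableSpace H] [BorelSpace H] [SecondCountableTopology H] [MeasurableSpace Ω]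
  {μ : Measure Ω} [IsProbabilityMeasure μ]

/-- The case `k = 3` suffices, whatever the real number `c` subtracted from `‖Z‖ ^ 2`: the argument
is not circular even though a divergent integral would default to `0`. -/
theorem BernsteinSqNorm.memLp {e : HilbertBasis ι ℝ H} {Γ : H →L[ℝ] H} {Z : Ω → H}
    (hZm : Measurable Z) {C₀ : ℝ} (h : BernsteinSqNorm e Γ Z μ C₀) : MemLp Z 2 μ := by
  rw [memLp_two_iff_integrable_sq_norm hZm.aestronglyMeasurable]
  set c := ∫ ω', ‖Z ω'‖ ^ 2 ∂μ
  have h3 := (h 3 le_rfl).1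
  refine ((h3.add (integrable_const 1)).add (integrable_const |c|)).mono'
    (Measurable.aestronglyMeasurable (by fun_prop)) (Filter.Eventually.of_forall fun ω => ?_)
  rw [Real.norm_of_nonneg (by positivity)]
  simp only [Pi.add_apply]
  have h4 : ‖Z ω‖ ^ 2 ≤ |‖Z ω‖ ^ 2 - c| + |c| := by
    linarith [le_abs_self (‖Z ω‖ ^ 2 - c), le_abs_self c]
  have h5 : ∀ y : ℝ, 0 ≤ y → y ≤ y ^ 3 + 1 := fun y hy => by
    rcases le_total y 1 with h | h
    · have : 0 ≤ y ^ 3 := by positivity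
      linarith
    · nlinarith [mul_nonneg hy (by nlinarith : 0 ≤ y ^ 2 - 1)]
  linarith [h5 _ (abs_nonneg (‖Z ω‖ ^ 2 - c))]

theorem expMoment_sqNorm_le {e : HilbertBasis ι ℝ H} {Γ : H →L[ℝ] H}
    (hΓ : IsPositiveTraceClass e Γ) {Z : Ω → H} (hZm : Measurable Z)
    (hZs : IsSubgaussian Γ Z μ) (hZ0 : ∫ ω, Z ω ∂μ = 0) {C₀ : ℝ} (hC : 0 ≤ C₀)
    (hB : BernsteinSqNorm e Γ Z μ C₀) {L : ℝ} (hL : psi2Norm Γ Z μ ≤ L) (hL0 : 0 < L)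
    (hΓ0 : 0 < ‖Γ‖) {x : ℝ} (hx : |x| * (L ^ 2 * ‖Γ‖) ≤ 1 / 2) :
    expMoment μ (fun ω => x * (‖Z ω‖ ^ 2 - ∫ ω', ‖Z ω'‖ ^ 2 ∂μ)) ≤
      ENNReal.ofReal (Real.exp ((1 + 24 * C₀) * (x ^ 2 * (L ^ 2 * hsNorm e Γ) ^ 2))) := by
  have hZ2 := hB.memLp hZm
  have hi : Integrable (fun ω => ‖Z ω‖ ^ 2) μ := (memLp_two_iff_integrable_sq_norm hZ2.1).1 hZ2
  have hle := norm_le_hsNorm hΓ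
  have hcov : hsNorm e (covarianceOperator (μ.map Z)) ≤ L ^ 2 * hsNorm e Γ :=
    hsNorm_covarianceOperator_le hΓ hZm hZ2 (sq_nonneg L)
      ((hZs.bound_of_psi2Norm_le hΓ.1 hL).integral_inner_sq_le hZ0 hZ2)
  have hcov0 : 0 ≤ hsNorm e (covarianceOperator (μ.map Z)) := Real.sqrt_nonneg _
  have hpsi := psi2Norm_nonneg Γ Z μ
  refine expMoment_le_of_bernstein (by fun_prop) (hi.sub (integrable_const _)) ?_ hC
    (b := L ^ 2 * ‖Γ‖) (by positivity) (mul_pos (by positivity) (hΓ0.trans_le hle)) (by gcongr)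
    (fun k hk => (hB k hk).1) (fun k hk => (hB k hk).2.trans ?_) hx
  · refine (integral_sub hi (integrable_const _)).trans ?_
    simp
  · gcongr

theorem quadForm_eq {n : ℕ} (A : Matrix (Fin n) (Fin n) ℝ) (X : Fin n → Ω → H) (ω : Ω) :
    quadForm A X ω = ∑ i, A i i * ‖X i ω‖ ^ 2 +
      ∑ i, ∑ j, if i = j then 0 else A i j * ⟪X i ω, X j ω⟫ := by
  rw [quadForm, ← Finset.sum_add_distrib]
  refine Finset.sum_congr rfl fun i _ => ?_
  rw [← Finset.add_sum_erase _ _ (Finset.mem_univ i), real_inner_self_eq_norm_sq,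
    ← Finset.add_sum_erase Finset.univ (fun j => if i = j then 0 else A i j * ⟪X i ω, X j ω⟫)
      (Finset.mem_univ i), if_pos rfl, zero_add]
  congr 1
  exact Finset.sum_congr rfl fun j hj => (if_neg (Finset.ne_of_mem_erase hj).symm).symm

theorem measurable_quadForm {n : ℕ} (A : Matrix (Fin n) (Fin n) ℝ) {X : Fin n → Ω → H}
    (hX : ∀ i, Measurable (X i)) : Measurable (quadForm A X) :=
  Finset.measurable_sum _ fun i _ => Finset.measurable_sum _ fun j _ =>
    ((hX i).inner (hX j)).const_mul _

theorem integrable_inner_of_memLp {Y Z : Ω → H} (hY : MemLp Y 2 μ) (hZ : MemLp Z 2 μ) :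
    Integrable (fun ω => ⟪Y ω, Z ω⟫) μ := by
  have h1 := (memLp_two_iff_integrable_sq_norm hY.1).1 hY
  have h2 := (memLp_two_iff_integrable_sq_norm hZ.1).1 hZ
  refine (h1.add h2).mono' (hY.1.inner hZ.1) (Filter.Eventually.of_forall fun ω => ?_)
  refine (norm_inner_le_norm _ _).trans ?_
  simp only [Pi.add_apply]
  nlinarith [sq_nonneg (‖Y ω‖ - ‖Z ω‖), sq_nonneg (‖Y ω‖), sq_nonneg (‖Z ω‖)]

theorem integrable_quadForm {n : ℕ} (A : Matrix (Fin n) (Fin n) ℝ) {X : Fin n → Ω → H}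
    (hX : ∀ i, MemLp (X i) 2 μ) : Integrable (quadForm A X) μ :=
  integrable_finsetSum _ fun i _ => integrable_finsetSum _ fun j _ =>
    (integrable_inner_of_memLp (hX i) (hX j)).const_mul _

theorem integral_quadForm {n : ℕ} (A : Matrix (Fin n) (Fin n) ℝ) {X : Fin n → Ω → H}
    (hX : ∀ i, MemLp (X i) 2 μ) (hind : iIndepFun X μ) (h0 : ∀ i, ∫ ω, X i ω ∂μ = 0) :
    ∫ ω, quadForm A X ω ∂μ = ∑ i, A i i * ∫ ω, ‖X i ω‖ ^ 2 ∂μ := by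
  have hi := fun i j => (integrable_inner_of_memLp (hX i) (hX j)).const_mul (A i j)
  simp only [quadForm]
  rw [integral_finsetSum _ fun i _ => integrable_finsetSum _ fun j _ => hi i j]
  refine Finset.sum_congr rfl fun i _ => ?_
  rw [integral_finsetSum _ fun j _ => hi i j, Finset.sum_eq_single i]
  · simp_rw [integral_const_mul, real_inner_self_eq_norm_sq]
  · intro j _ hj
    have h : ∫ ω, ⟪X i ω, X j ω⟫ ∂μ = ⟪∫ ω, X i ω ∂μ, ∫ ω, X j ω ∂μ⟫ :=
      (hind.indepFun hj.symm).integral_bilin ((hX i).integrable (by norm_num))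
      ((hX j).integrable (by norm_num)) (innerSL ℝ)
    rw [integral_const_mul, h, h0, inner_zero_left, mul_zero]
  · simp

/-- Both parts are taken at `2 * l`, to be averaged with weights `1 / 2`. The diagonal costs `4 * (1
+ 24 * C₀)` and the off-diagonal `16 * 4 = 64`; `68 + 96 * C₀`, their sum, serves as the common
bound. The threshold `1 / 12` gives `64 / 144 ≤ 1 / 2`, as decoupling requires. -/
theorem expMoment_quadForm_sub_le {e : HilbertBasis ι ℝ H} {Γ : H →L[ℝ] H}
    (hΓ : IsPositiveTraceClass e Γ) {n : ℕ} {X : Fin n → Ω → H} (hX : ∀ i, Measurable (X i))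
    (hind : iIndepFun X μ) (hsub : ∀ i, IsSubgaussian Γ (X i) μ)
    (h0 : ∀ i, ∫ ω, X i ω ∂μ = 0) {C₀ : ℝ} (hC : 0 ≤ C₀)
    (hB : ∀ i, BernsteinSqNorm e Γ (X i) μ C₀) (A : Matrix (Fin n) (Fin n) ℝ) {L : ℝ}
    (hL : ∀ i, psi2Norm Γ (X i) μ ≤ L) (hL0 : 0 < L) (hΓ0 : 0 < ‖Γ‖) {l : ℝ}
    (hl : |l| * (L ^ 2 * ‖Γ‖ * matOpNorm A) ≤ 1 / 12) :
    expMoment μ (fun ω => l * (quadForm A X ω - ∫ ω', quadForm A X ω' ∂μ)) ≤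
      ENNReal.ofReal (Real.exp ((68 + 96 * C₀) * l ^ 2 *
        (L ^ 4 * hsNorm e Γ ^ 2 * matHSNorm A ^ 2))) := by
  have hA0 := matOpNorm_nonneg A
  set v := L ^ 4 * hsNorm e Γ ^ 2 * matHSNorm A ^ 2 with hv
  set D : Ω → ℝ := fun ω => ∑ i, 2 * l * A i i * (‖X i ω‖ ^ 2 - ∫ ω', ‖X i ω'‖ ^ 2 ∂μ) with hD
  set O : Ω → ℝ := fun ω => 2 * l * ∑ i, ∑ j, if i = j then 0 else A i j * ⟪X i ω, X j ω⟫ with hO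
  have hDm : ∀ i, Measurable
      fun ω => 2 * l * A i i * (‖X i ω‖ ^ 2 - ∫ ω', ‖X i ω'‖ ^ 2 ∂μ) :=
    fun i => by have := hX i; fun_prop
  have hDle : expMoment μ D ≤ ENNReal.ofReal (Real.exp ((68 + 96 * C₀) * l ^ 2 * v)) := by
    rw [hD, expMoment_sum_eq_prod
      (Y := fun i ω => 2 * l * A i i * (‖X i ω‖ ^ 2 - ∫ ω', ‖X i ω'‖ ^ 2 ∂μ))
      (hind.comp (fun i x => 2 * l * A i i * (‖x‖ ^ 2 - ∫ ω', ‖X i ω'‖ ^ 2 ∂μ))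
        fun _ => by fun_prop) hDm]
    refine (Finset.prod_le_prod' fun i _ => expMoment_sqNorm_le hΓ (hX i) (hsub i) (h0 i) hC
      (hB i) (hL i) hL0 hΓ0 ?_).trans ?_
    · rw [abs_mul, abs_mul, abs_two]
      have h1 := abs_apply_le_matOpNorm A i i
      calc 2 * |l| * |A i i| * (L ^ 2 * ‖Γ‖) ≤ 2 * |l| * matOpNorm A * (L ^ 2 * ‖Γ‖) := by
            gcongr
        _ ≤ 1 / 2 := by linarith
    · rw [← ENNReal.ofReal_prod_of_nonneg fun i _ => (Real.exp_pos _).le, ← Real.exp_sum]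
      refine ENNReal.ofReal_le_ofReal (Real.exp_le_exp.2 ?_)
      have h1 : ∑ i, A i i ^ 2 ≤ matHSNorm A ^ 2 := by
        rw [matHSNorm_sq]
        exact Finset.sum_le_sum fun i _ =>
          Finset.single_le_sum (f := fun j => A i j ^ 2) (fun _ _ => sq_nonneg _)
            (Finset.mem_univ i)
      calc _ = (4 + 96 * C₀) * l ^ 2 * (L ^ 4 * hsNorm e Γ ^ 2 * ∑ i, A i i ^ 2) := by
            simp_rw [Finset.mul_sum]
            exact Finset.sum_congr rfl fun i _ => by ring
        _ ≤ (68 + 96 * C₀) * l ^ 2 * (L ^ 4 * hsNorm e Γ ^ 2 * matHSNorm A ^ 2) := by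
            gcongr
            norm_num
  have hOle : expMoment μ O ≤ ENNReal.ofReal (Real.exp ((68 + 96 * C₀) * l ^ 2 * v)) := by
    have hsq : (|l| * (L ^ 2 * ‖Γ‖ * matOpNorm A)) ^ 2 ≤ (1 / 12) ^ 2 :=
      pow_le_pow_left₀ (by positivity) hl 2
    rw [mul_pow, sq_abs] at hsq
    refine (expMoment_offDiag_le hX hind hΓ (L := L) (a := matOpNorm A) (l := 2 * l)
      (fun i z => ((hsub i).bound_of_psi2Norm_le hΓ.1 (hL i)).expMoment_le (h0 i) z) A
      (sum_sq_mulVec_le A) ?_).trans ?_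
    · nlinarith
    · refine ENNReal.ofReal_le_ofReal (Real.exp_le_exp.2 ?_)
      rw [← matHSNorm_sq, ← hv]
      have : 0 ≤ l ^ 2 * v := by positivity
      nlinarith [mul_nonneg hC this]
  have hOm : Measurable O := by
    refine Measurable.const_mul (Finset.measurable_sum _ fun i _ =>
      Finset.measurable_sum _ fun j _ => ?_) _
    have := hX i
    have := hX j
    split_ifs <;> fun_prop
  have heq : ∀ ω, l * (quadForm A X ω - ∫ ω', quadForm A X ω' ∂μ) =
      ∑ b : Bool, (1 / 2 : ℝ) * (bif b then D else O) ω := by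
    intro ω
    rw [integral_quadForm A (fun i => (hB i).memLp (hX i)) hind h0, quadForm_eq,
      Fintype.sum_bool]
    simp only [hD, hO, cond_true, cond_false, mul_sub, Finset.sum_sub_distrib]
    have h1 : ∀ c : Fin n → ℝ, ∑ i, 2 * l * A i i * c i = 2 * (l * ∑ i, A i i * c i) := by
      intro c
      simp_rw [Finset.mul_sum]
      exact Finset.sum_congr rfl fun i _ => by ring
    rw [h1, h1]
    ring
  rw [expMoment_congr heq]
  refine expMoment_convexComb_le (fun _ => by norm_num) (by norm_num) (fun b => ?_) fun b => ?_
  · cases b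
    · exact hOm
    · exact Finset.measurable_sum _ fun i _ => hDm i
  · cases b
    · exact hOle
    · exact hDle

theorem ae_eq_zero_of_variance_bound {Z : Ω → H} (hZ2 : MemLp Z 2 μ)
    (h : ∀ z, ∫ ω, ⟪z, Z ω⟫ ^ 2 ∂μ ≤ 0) : Z =ᵐ[μ] 0 := by
  refine ae_eq_zero_of_forall_inner (𝕜 := ℝ) fun z => ?_
  have hi : Integrable (fun ω => ⟪z, Z ω⟫ ^ 2) μ := (hZ2.const_inner z).integrable_sq
  have h1 := (integral_eq_zero_iff_of_nonneg (fun ω => sq_nonneg _) hi).1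
    (le_antisymm (h z) (integral_nonneg fun ω => sq_nonneg _))
  filter_upwards [h1] with ω hω
  simpa using hω

/-- If `L` or `Γ` vanishes, the variance bound `L ^ 2 * ⟪Γ z, z⟫` forces every `X i` to be null;
otherwise `A = 0`. -/
theorem quadForm_ae_eq_zero {e : HilbertBasis ι ℝ H} {Γ : H →L[ℝ] H}
    (hΓ : IsPositiveTraceClass e Γ) {n : ℕ} {X : Fin n → Ω → H}
    (hX : ∀ i, MemLp (X i) 2 μ) (hsub : ∀ i, IsSubgaussian Γ (X i) μ)
    (h0 : ∀ i, ∫ ω, X i ω ∂μ = 0) (A : Matrix (Fin n) (Fin n) ℝ) {L : ℝ}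
    (hL : ∀ i, psi2Norm Γ (X i) μ ≤ L) (hdeg : L ^ 2 * ‖Γ‖ * matOpNorm A = 0) :
    quadForm A X =ᵐ[μ] 0 := by
  rcases mul_eq_zero.1 hdeg with h | h
  · have hz : ∀ z, L ^ 2 * ⟪Γ z, z⟫ = 0 := by
      intro z
      rcases mul_eq_zero.1 h with h | h
      · rw [h, zero_mul]
      · rw [norm_eq_zero.1 h]; simp
    have hXz : ∀ i, X i =ᵐ[μ] 0 := fun i =>
      ae_eq_zero_of_variance_bound (hX i) fun z =>
        (((hsub i).bound_of_psi2Norm_le hΓ.1 (hL i)).integral_inner_sq_le (h0 i) (hX i) z).trans_eq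
          (hz z)
    filter_upwards [ae_all_iff.2 hXz] with ω hω
    simp [quadForm, hω]
  · refine Filter.Eventually.of_forall fun ω => ?_
    have hA : ∀ i j, A i j = 0 := fun i j =>
      abs_nonpos_iff.1 ((abs_apply_le_matOpNorm A i j).trans_eq h)
    simp [quadForm, hA]

end Main

end HilbertHW

end

/-! ### The Hanson–Wright inequality -/

open HilbertHW in
theorem theorem2p3 (C₀ : ℝ) (hC₀ : 0 < C₀) :
    ∃ C : ℝ, 0 < C ∧
      ∀ (H : Type*) [NormedAddCommGroup H] [InnerProductSpace ℝ H] [CompleteSpace H]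
        [TopologicalSpace.SeparableSpace H] [MeasurableSpace H] [BorelSpace H]
        (ι : Type*) (e : HilbertBasis ι ℝ H)
        (Γ : H →L[ℝ] H) (_ : IsPositiveTraceClass e Γ)
        (Ω : Type*) [MeasurableSpace Ω] (μ : Measure Ω) [IsProbabilityMeasure μ]
        (n : ℕ) (X : Fin n → Ω → H)
        (_ : ∀ i, Measurable (X i)) (_ : iIndepFun X μ)
        (_ : ∀ i, IsSubgaussian Γ (X i) μ) (_ : ∀ i, ∫ ω, X i ω ∂μ = 0)
        (_ : ∀ i, BernsteinSqNorm e Γ (X i) μ C₀)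
        (A : Matrix (Fin n) (Fin n) ℝ) (L : ℝ) (_ : L = ⨆ i, psi2Norm Γ (X i) μ),
        Integrable (quadForm A X) μ ∧
        ∀ t : ℝ, 0 < t →
          μ.real {ω | t ≤ |quadForm A X ω - ∫ ω', quadForm A X ω' ∂μ|} ≤
              2 * Real.exp (-C * min
                (t ^ 2 / (L ^ 4 * hsNorm e Γ ^ 2 * matHSNorm A ^ 2))
                (t / (L ^ 2 * ‖Γ‖ * matOpNorm A))) ∧
          -- if the denominators vanish, the quotients are `+∞` and the bound is `0`
          (L ^ 2 * ‖Γ‖ * matOpNorm A = 0 →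
            μ.real {ω | t ≤ |quadForm A X ω - ∫ ω', quadForm A X ω' ∂μ|} = 0) := by
  -- The constant of `measureReal_abs_ge_le` for `K = 68 + 96 * C₀` and `r = 1 / 12`.
  refine ⟨min (1 / (4 * (68 + 96 * C₀))) (1 / 12 / 2),
    lt_min (by positivity) (by norm_num), ?_⟩
  intro H _ _ _ _ _ _ ι e Γ hΓ Ω _ μ _ n X hX hind hsub h0 hB A L hLdef
  have : SecondCountableTopology H := UniformSpace.secondCountable_of_separable H
  have hL : ∀ i, psi2Norm Γ (X i) μ ≤ L := fun i => by
    rw [hLdef]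
    exact le_ciSup (Set.finite_range fun i => psi2Norm Γ (X i) μ).bddAbove i
  have hX2 : ∀ i, MemLp (X i) 2 μ := fun i => (hB i).memLp (hX i)
  refine ⟨integrable_quadForm A hX2, fun t ht => ?_⟩
  have hzero : L ^ 2 * ‖Γ‖ * matOpNorm A = 0 →
      μ.real {ω | t ≤ |quadForm A X ω - ∫ ω', quadForm A X ω' ∂μ|} = 0 := by
    intro hdeg
    have hQ := quadForm_ae_eq_zero hΓ hX2 hsub h0 A hL hdeg
    have hQi : ∫ ω', quadForm A X ω' ∂μ = 0 := by rw [integral_congr_ae hQ]; simp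
    rw [measureReal_eq_zero_iff, hQi]
    have hlt : ∀ᵐ ω ∂μ, ¬ t ≤ |quadForm A X ω - 0| := by
      filter_upwards [hQ] with ω hω
      simpa [hω] using ht
    simpa only [not_not] using ae_iff.1 hlt
  refine ⟨?_, hzero⟩
  -- Here the quotients take the default value of division by zero, but the probability is `0` and
  -- the bound is positive regardless.
  by_cases hdeg : L ^ 2 * ‖Γ‖ * matOpNorm A = 0
  · rw [hzero hdeg]
    positivity
  have hLnn : 0 ≤ L := by
    rw [hLdef]
    exact Real.iSup_nonneg fun i => psi2Norm_nonneg _ _ _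
  have hL0 : 0 < L := hLnn.lt_of_ne' fun h => hdeg (by rw [h]; ring)
  have hΓ0 : 0 < ‖Γ‖ := (norm_nonneg Γ).lt_of_ne' fun h => hdeg (by rw [h]; ring)
  have hA0 : 0 < matOpNorm A := (matOpNorm_nonneg A).lt_of_ne' fun h => hdeg (by rw [h]; ring)
  have hhs : 0 < hsNorm e Γ := hΓ0.trans_le (norm_le_hsNorm hΓ)
  have hA2 := matHSNorm_pos A hA0
  exact measureReal_abs_ge_le ((measurable_quadForm A hX).sub_const _) (by positivity)
    (by norm_num) (by positivity) (by positivity)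
    (fun l hl => expMoment_quadForm_sub_le hΓ hX hind hsub h0 hC₀.le hB A hL hL0 hΓ0 hl) ht
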